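/- **Setting.** Let $L=L_1\cup\dots\cup L_n$ be a family of arcs in $\mathbb R^3$ with pairwise disjoint components (a component may intersect itself), each endpoint $x$ being constrained to an affine subspace $M_x$, and $L$ being constrained to avoid finitely many obstacles $\{g_j<0\}$, where $g_j$ is $C^1$ with regular value $0$. Its *Gehring thickness* $\mathrm{gThi}(L)$ is the minimal distance between points on different components, and $O(L)=\min_j\min_{x\in L}g_j(x)$. A continuous vector field $\xi$ along $L$ (a function of the parameter, so that it may take different values at a self-intersection) is *compatible* if it is tangent to $M_x$ at each endpoint $x$. The first variation of length $\delta_\xi\mathrm{Len}$ is the derivative of length along $C^1$ vector fields $\xi$, extended continuously to all continuous $\xi$; $\delta^+_\xi$ denotes the one-sided derivative at $t=0^+$ along $L+t\xi$. $L$ is *strongly critical* for Gehring ropelength if $\delta\mathrm{Len}$ exists as a continuous functional and there is $\varepsilon>0$ such that for every compatible $\xi$ with $\delta_\xi\mathrm{Len}=-1$ the one-sided variations exist and $\min\big(\delta^+_\xi\mathrm{gThi}(L),\delta^+_\xi O(L)\big)\le-\varepsilon$. Two configurations are *link-homotopic* if they are joined by a homotopy during which different components stay disjoint (a component may cross itself),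 endpoints stay in their subspaces and the obstacles are avoided. **Clasp arcs.** The $\tau=1$ clasp arc is the planar arc with horizontal coordinate $X(u)$ and height $Z(u)$, $0\le u\le1$, where $$X(u)=\sqrt{\frac{u^2\,(1-(1-u)^2)}{1-u^2(1-u)^2}},\qquad Z(u)=\int_0^u\frac{w}{\sqrt{1-w^2}}\,X'(w)\,dw ,$$ which has a horizontal tangent at $u=0$ and a vertical one at $u=1$. Put $H=Z(1)$. **Configuration.** Let $d>0$ and $c=\tfrac32H+d$. The floor is the plane $z=-c$ and the ceiling the plane $z=c$. The component $\beta$ lies in the plane $x_2=0$ with both endpoints on the floor, and is symmetric under $x_1\mapsto-x_1$. One half of it, in $(x_1,z)$-coordinates, consists of the vertical segment from $(1,-c)$ to $(1,-\tfrac32H)$, followed by the three clasp arcs $(X(u),-\tfrac12H-Z(u))$ with $u$ from $1$ to $0$, ending at $p=(0,-\tfrac12H)$; then $(-X(u),-\tfrac12H+Z(u))$ with $u$ from $0$ to $1$; then $(-X(u),\tfrac32H-Z(u))$ with $u$ from $1$ to $0$, ending at the tip $t=(0,\tfrac32H)$. The other half is its mirror image. The component $\gamma$ is the image of $\beta$ under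 the rotation $(x_1,x_2,z)\mapsto(x_2,x_1,-z)$; it lies in the perpendicular plane $x_1=0$ with its endpoints on the ceiling. Each endpoint is constrained to its floor or ceiling plane, and the half-spaces below the floor and above the ceiling are obstacles. **The granny clasp** $G_1$ is the link-homotopy class, with these constraints, of the following picture: near each of the two vertical lines $x_1=\pm2,\ x_2=0$, one strand of a rope with both ends on the floor and one strand of a rope with both ends on the ceiling are twisted around each other by three half-twists, of the same handedness on both sides; above the twists the two strands of the lower rope are joined, and below the twists the two strands of the upper rope are joined. (Joining the two free ends on the left and the two on the right gives a granny knot.) **Theorem 7.1.** For every $d>0$ the configuration $\beta\cup\gamma$ satisfies all the constraints, has Gehring thickness $1$, belongs to the link-homotopy class $G_1$, is not embedded (each component has exactly one point of self-intersection), and is strongly critical for Gehring ropelength. -/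

import Mathlib

noncomputable section

namespace Gehring

open Set unitInterval

/-- Euclidean three-space, with coordinates `x₁ = q 0`, `x₂ = q 1`, `z = q 2`. -/
abbrev E3 : Type := EuclideanSpace ℝ (Fin 3)

/-- The data of a generalized link all of whose components are arcs.  The components are indexed
by `ι` and parametrized by `[0,1]`; each endpoint is constrained to an affine subspace; and there
is an obstacle `{q | g j q < 0}` for each `j : J`. The conditions relating these data are in
`GenLink.IsGenLink`. -/
structure GenLink (ι J : Type) where
  /-- the components -/
  arc : ι → I → E3
  /-- the affine subspace to which the starting point `arc i 0` is constrained -/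
  M₀ : ι → AffineSubspace ℝ E3
  /-- the affine subspace to which the final point `arc i 1` is constrained -/
  M₁ : ι → AffineSubspace ℝ E3
  /-- the obstacle functions -/
  g : J → E3 → ℝ

/-- Total length of a family of arcs. -/
def len {ι : Type} [Fintype ι] (γ : ι → I → E3) : ℝ :=
  ∑ i, (eVariationOn (γ i) univ).toReal

/-- Gehring thickness: the minimal distance between points on different components. -/
def gThi {ι : Type} (γ : ι → I → E3) : ℝ :=
  sInf {r | ∃ i j, i ≠ j ∧ ∃ s t : I, r = dist (γ i s) (γ j t)}

/-- The obstacle function `min_j min_{x ∈ L} g_j(x)`. If there are no obstacles at all this is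
the constant `0`, so that the condition on its first variation in `GenLink.StronglyCritical`
is then void, as it should be. -/
def obst {ι J : Type} (g : J → E3 → ℝ) (γ : ι → I → E3) : ℝ :=
  sInf {r | ∃ j i, ∃ s : I, r = g j (γ i s)}

/-- The arcs, moved for time `t` with velocity `ξ`. -/
def move {ι : Type} (γ : ι → I → E3) (ξ : ι → C(I, E3)) (t : ℝ) : ι → I → E3 :=
  fun i s => γ i s + t • ξ i s

/-- The family of arcs `γ` is admissible for the constraints of `L`: its components are pairwise
disjoint (a single component may intersect itself), its endpoints lie on the prescribed affine
subspaces, and it avoids the obstacles. -/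
def GenLink.Admits {ι J : Type} (L : GenLink ι J) (γ : ι → I → E3) : Prop :=
  (∀ i j, i ≠ j → ∀ s t : I, γ i s ≠ γ j t) ∧
  (∀ i, γ i 0 ∈ L.M₀ i ∧ γ i 1 ∈ L.M₁ i) ∧
  (∀ j i, ∀ s : I, 0 ≤ L.g j (γ i s))

/-- `L` is a generalized link: its arcs are continuous and admissible, and every obstacle function
is `C¹` and has `0` as a regular value. -/
def GenLink.IsGenLink {ι J : Type} (L : GenLink ι J) : Prop :=
  (∀ i, Continuous (L.arc i)) ∧ L.Admits L.arc ∧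
  (∀ j, ContDiff ℝ 1 (L.g j) ∧ ∀ q, L.g j q = 0 → fderiv ℝ (L.g j) q ≠ 0)

/-- Link homotopy of `L` to the arcs `δ` under the constraints of `L`: the components stay
disjoint from each other, but may cross themselves; the endpoints move within their affine
subspaces, and the obstacles are avoided. -/
def GenLink.LinkHomotopicTo {ι J : Type} (L : GenLink ι J) (δ : ι → I → E3) : Prop :=
  ∃ h : ι → I × I → E3, (∀ i, Continuous (h i)) ∧
    (∀ i s, h i (0, s) = L.arc i s) ∧ (∀ i s, h i (1, s) = δ i s) ∧
    ∀ τ : I, L.Admits fun i s => h i (τ, s)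

/-- A continuous vector field along `L` is compatible if it is tangent, at each endpoint, to the
affine subspace to which that endpoint is constrained. -/
def GenLink.Compatible {ι J : Type} (L : GenLink ι J) (ξ : ι → C(I, E3)) : Prop :=
  ∀ i, ξ i 0 ∈ (L.M₀ i).direction ∧ ξ i 1 ∈ (L.M₁ i).direction

/-- `F` is the first variation of length `ξ ↦ δ_ξ Len` of the arcs `γ`. The arcs are rectifiable,
`F` is the derivative of length along every `C¹` vector field, and it is extended to continuous
vector fields by continuity, that is (Riesz), as minus the integral against a vector-valued
Radon measure, the curvature force. As `C¹` fields are dense, there is at most one such `F`. -/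
def IsFirstVariationOfLen {ι : Type} [Fintype ι] (γ : ι → I → E3)
    (F : (ι → C(I, E3)) →L[ℝ] ℝ) : Prop :=
  (∀ i, eVariationOn (γ i) univ ≠ ⊤) ∧
  ∀ ξ : ι → C(I, E3),
    (∀ i, ∃ f : ℝ → E3, ContDiff ℝ 1 f ∧ ∀ s : I, ξ i s = f s) →
    HasDerivAt (fun t : ℝ => len (move γ ξ t)) (F ξ) 0

/-- Strong criticality for length when constrained by Gehring thickness (and by the endpoint
constraints and obstacles). The numbers `a` and `b` are the one-sided first variations of the
Gehring thickness and of the obstacle function; their existence is part of the claim. -/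
def GenLink.StronglyCritical {ι J : Type} [Fintype ι] (L : GenLink ι J) : Prop :=
  ∃ F : (ι → C(I, E3)) →L[ℝ] ℝ, IsFirstVariationOfLen L.arc F ∧
    ∃ ε : ℝ, 0 < ε ∧ ∀ ξ : ι → C(I, E3), L.Compatible ξ → F ξ = -1 →
      ∃ a b : ℝ,
        HasDerivWithinAt (fun t : ℝ => gThi (move L.arc ξ t)) a (Ici 0) 0 ∧
        HasDerivWithinAt (fun t : ℝ => obst L.g (move L.arc ξ t)) b (Ici 0) 0 ∧
        min a b ≤ -ε

/-! ### The `τ = 1` clasp arc -/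

/-- Horizontal coordinate on the `τ = 1` clasp arc, at the point where the unit tangent vector has
vertical component `u ∈ [0,1]`. It comes from
`x₁² = u₁² (1 - u₂²) / (1 - u₁² u₂²)` and the balance equation `u₁ + u₂ = 1`. -/
def claspX (u : ℝ) : ℝ :=
  Real.sqrt (u ^ 2 * (1 - (1 - u) ^ 2) / (1 - u ^ 2 * (1 - u) ^ 2))

/-- Height above the tip on the `τ = 1` clasp arc, from `dz/dx = u / √(1 - u²)`. -/
def claspZ (u : ℝ) : ℝ :=
  ∫ w in (0 : ℝ)..u, w / Real.sqrt (1 - w ^ 2) * deriv claspX w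

/-- The vertical extent of one `τ = 1` clasp (which is the height of each clasp arc). -/
def claspH : ℝ := claspZ 1

/-! ### The critical configuration of the granny clasp

The levels of `t'`, `p`, `p'`, `t` are `-3H/2`, `-H/2`, `H/2`, `3H/2`, with `H = claspH`. The floor
and the ceiling are at distance `d` below `t'` and above `t`, that is at height `∓(3H/2 + d)`. -/

/-- The height of the ceiling above the middle level, if the straight segments have length `d`. -/
def ceil (d : ℝ) : ℝ := 3 * claspH / 2 + d

/-- Horizontal coordinate (in the plane `x₂ = 0`) of the half of `β` that starts on the right:
a vertical segment (`0 ≤ s ≤ 1`) and three clasp arcs, `1 ≤ s ≤ 2` up to the point `p` of the axis,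
then on the other side of the axis `2 ≤ s ≤ 3` up to the level of `p'`, and `3 ≤ s ≤ 4` up to the
tip `t`. -/
def halfX (s : ℝ) : ℝ :=
  if s ≤ 1 then 1
  else if s ≤ 2 then claspX (2 - s)
  else if s ≤ 3 then -claspX (s - 2)
  else -claspX (4 - s)

/-- Height of the same half of `β`. -/
def halfZ (d s : ℝ) : ℝ :=
  if s ≤ 1 then -ceil d + s * d
  else if s ≤ 2 then -claspH / 2 - claspZ (2 - s)
  else if s ≤ 3 then -claspH / 2 + claspZ (s - 2)
  else 3 * claspH / 2 - claspZ (4 - s)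

/-- The component `β` attached to the floor: the half above, up to the tip, followed by its mirror
image in the `z`-axis, traversed downwards. -/
def beta (d : ℝ) (s : I) : E3 :=
  if (s : ℝ) ≤ 1 / 2 then !₂[halfX (8 * s), 0, halfZ d (8 * s)]
  else !₂[-halfX (8 * (1 - s)), 0, halfZ d (8 * (1 - s))]

/-- The component `γ` attached to the ceiling: the image of `β` under the rotation
`(x₁, x₂, z) ↦ (x₂, x₁, -z)`. -/
def gamma (d : ℝ) (s : I) : E3 := !₂[beta d s 1, beta d s 0, -(beta d s 2)]

/-- The horizontal plane at height `c`. -/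
def horizontalPlane (c : ℝ) : AffineSubspace ℝ E3 :=
  AffineSubspace.mk' !₂[0, 0, c] (LinearMap.ker (EuclideanSpace.proj (𝕜 := ℝ) (2 : Fin 3) : E3 →L[ℝ] ℝ).toLinearMap)

/-- The granny clasp in its configuration built from clasp arcs: component `0` is `β`, with both
ends on the floor, component `1` is `γ`, with both ends on the ceiling; the half-spaces below the
floor and above the ceiling are obstacles. -/
def grannyClasp (d : ℝ) : GenLink (Fin 2) (Fin 2) where
  arc := ![beta d, gamma d]
  M₀ := ![horizontalPlane (-ceil d), horizontalPlane (ceil d)]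
  M₁ := ![horizontalPlane (-ceil d), horizontalPlane (ceil d)]
  g := ![fun q => q 2 + ceil d, fun q => ceil d - q 2]

/-! ### The link-homotopy class

The standard picture of the granny clasp between the floor `z = -h` and the ceiling `z = h`. Near
each of the two vertical lines `x₁ = ±2`, `x₂ = 0`, one strand of the lower rope and one strand of
the upper rope are twisted around each other by three right-handed half-twists. Above the twists
the two strands of the lower rope are joined, below them the two strands of the upper rope. (Joining
the two free ends at the left and the two free ends at the right gives the connect sum of two
trefoils of the same handedness.) -/

/-- Twisting angle at height `ζ h`; it runs from `0` to `3π` for `-1/3 ≤ ζ ≤ 1/3`. -/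
def twist (ζ : ℝ) : ℝ := 3 * Real.pi * (3 * ζ + 1) / 2

/-- First horizontal coordinate, at height `ζ h` with `-1 ≤ ζ ≤ 2/3`, of the strand of the lower
rope on the right: it goes straight up, is twisted, and then leads to the tip on the axis. -/
def strandX (ζ : ℝ) : ℝ :=
  if ζ ≤ -1 / 3 then 3 else if ζ ≤ 1 / 3 then 2 + Real.cos (twist ζ) else 2 - 3 * ζ

/-- Second horizontal coordinate of that strand. -/
def strandY (ζ : ℝ) : ℝ :=
  if ζ ≤ -1 / 3 then 0 else if ζ ≤ 1 / 3 then Real.sin (twist ζ) else 0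

/-- The lower rope: the strand on the right traversed upwards, at height `ζ h` with `ζ` running from
`-1` to `2/3`, followed by its image under the half-turn about the `z`-axis, traversed downwards. -/
def lowerRope (h : ℝ) (s : I) : E3 :=
  if (s : ℝ) ≤ 1 / 2 then
    !₂[strandX (-1 + 10 / 3 * s), strandY (-1 + 10 / 3 * s), h * (-1 + 10 / 3 * s)]
  else
    !₂[-strandX (-1 + 10 / 3 * (1 - s)), -strandY (-1 + 10 / 3 * (1 - s)),
      h * (-1 + 10 / 3 * (1 - s))]

/-- The upper rope: the image of the lower rope under the half-turn about the `x₁`-axis. -/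
def upperRope (h : ℝ) (s : I) : E3 :=
  !₂[lowerRope h s 0, -(lowerRope h s 1), -(lowerRope h s 2)]

/-- The two ropes in the standard picture of the granny clasp. -/
def grannyPicture (h : ℝ) : Fin 2 → I → E3 := ![lowerRope h, upperRope h]

end Gehring

end

noncomputable section

namespace Gehring

open Set unitInterval MeasureTheory Filter Topology

/-! The curves `β` and `γ` lie in perpendicular planes through the `z`-axis and face each other in
three clasps. There the point of a `β`-arc at parameter `u` and the point of a `γ`-arc at parameter
`1 - u` are at distance exactly `1`, and no two points of `β` and `γ` are closer. The clasp arc is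
shaped so that `claspX u = gap u * claspSlope u`, which says that the curvature forces of the arcs
are balanced by these struts, with density proportional to `1 / gap u`. Since `1 / gap` has a finite
integral, a compatible field that shortens the length at unit rate must shorten some strut at a rate
bounded below by a multiple of the reciprocal of that integral. As a minimum of distances over a
compact space, the thickness has a one-sided derivative, equal to the least derivative among the
struts (Danskin). -/

/-! ### The length of an arc -/

section ArcLength

lemma eVariationOn_le_of_edist_le {α E F : Type*} [LinearOrder α] [PseudoEMetricSpace E]
    [PseudoEMetricSpace F] {f : α → E} {g : α → F} {s : Set α}
    (h : ∀ x ∈ s, ∀ y ∈ s, x ≤ y → edist (f x) (f y) ≤ edist (g x) (g y)) :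
    eVariationOn f s ≤ eVariationOn g s := by
  refine iSup_le fun ⟨n, u, hu, hus⟩ => ?_
  refine (Finset.sum_le_sum fun i _ => ?_).trans (eVariationOn.sum_le (f := g) (n := n) hu hus)
  rw [edist_comm, edist_comm (g _)]
  exact h _ (hus i) _ (hus (i + 1)) (hu i.le_succ)

lemma eVariationOn_le_of_dist_le_sub {α E : Type*} [LinearOrder α] [PseudoMetricSpace E]
    {f : α → E} {G : α → ℝ} {a b : α} (hab : a ≤ b)
    (h : ∀ x ∈ Icc a b, ∀ y ∈ Icc a b, x ≤ y → dist (f x) (f y) ≤ G y - G x) :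
    eVariationOn f (Icc a b) ≤ ENNReal.ofReal (G b - G a) := by
  have hG : MonotoneOn G (Icc a b) := fun x hx y hy hxy =>
    sub_nonneg.1 (dist_nonneg.trans (h x hx y hy hxy))
  refine (eVariationOn_le_of_edist_le (g := G) fun x hx y hy hxy => ?_).trans ?_
  · rw [edist_dist, edist_dist, dist_comm (G x), Real.dist_eq,
      abs_of_nonneg (sub_nonneg.2 (hG hx hy hxy))]
    exact ENNReal.ofReal_le_ofReal (h x hx y hy hxy)
  · simpa only [inter_self] using
      (hG.eVariationOn_eq (left_mem_Icc.2 hab) (right_mem_Icc.2 hab)).le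

lemma eVariationOn_inter_Icc_le {α E : Type*} [LinearOrder α] [PseudoMetricSpace E]
    {f : α → E} {G : α → ℝ} {a b : α}
    (hfG : ∀ x ∈ Icc a b, ∀ y ∈ Icc a b, x ≤ y → dist (f x) (f y) ≤ G y - G x)
    {x y : α} (hx : x ∈ Icc a b) (hy : y ∈ Icc a b) (hxy : x ≤ y) :
    eVariationOn f (Icc a b ∩ Icc x y) ≤ ENNReal.ofReal (G y - G x) := by
  have hsub : Icc x y ⊆ Icc a b := Icc_subset_Icc hx.1 hy.2
  rw [inter_eq_right.2 hsub]
  exact eVariationOn_le_of_dist_le_sub hxy fun w hw z hz => hfG w (hsub hw) z (hsub hz)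

lemma dist_le_variationOnFromTo_sub {α E : Type*} [LinearOrder α] [PseudoMetricSpace E]
    {f : α → E} {s : Set α} (hf : LocallyBoundedVariationOn f s) {a x y : α} (ha : a ∈ s)
    (hx : x ∈ s) (hy : y ∈ s) (hxy : x ≤ y) :
    dist (f x) (f y) ≤ variationOnFromTo f s a y - variationOnFromTo f s a x := by
  rw [variationOnFromTo.sub_right hf ha hy hx, variationOnFromTo.eq_of_le f s hxy, dist_edist]
  exact ENNReal.toReal_mono (hf x y hx hy)
    (eVariationOn.edist_le f ⟨hx, le_rfl, hxy⟩ ⟨hy, hxy, le_rfl⟩)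

lemma continuousOn_of_abs_sub_le {α : Type*} [TopologicalSpace α] {V G : α → ℝ} {s : Set α}
    (h : ∀ x ∈ s, ∀ y ∈ s, |V y - V x| ≤ |G y - G x|) (hG : ContinuousOn G s) :
    ContinuousOn V s := fun x hx => by
  refine tendsto_iff_dist_tendsto_zero.2 (squeeze_zero' (Eventually.of_forall fun _ => dist_nonneg)
    ?_ (tendsto_iff_dist_tendsto_zero.1 (hG x hx)))
  filter_upwards [self_mem_nhdsWithin] with y hy using h x hx y hy

variable {E : Type*} [NormedAddCommGroup E] [NormedSpace ℝ E]

lemma hasDerivWithinAt_of_dist_le_sub_le {f : ℝ → E} {f' : E} {V G : ℝ → ℝ} {x : ℝ}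
    (hf : HasDerivWithinAt f f' (Ioi x) x) (hG : HasDerivWithinAt G ‖f'‖ (Ioi x) x)
    (hfV : ∀ᶠ y in 𝓝[>] x, dist (f x) (f y) ≤ V y - V x)
    (hVG : ∀ᶠ y in 𝓝[>] x, V y - V x ≤ G y - G x) :
    HasDerivWithinAt V ‖f'‖ (Ioi x) x := by
  rw [hasDerivWithinAt_iff_tendsto_slope' self_notMem_Ioi] at hf hG ⊢
  refine tendsto_of_tendsto_of_tendsto_of_le_of_le' hf.norm hG ?_ ?_
  · filter_upwards [hfV, self_mem_nhdsWithin] with y hy hxy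
    have hpos : 0 < y - x := sub_pos.2 hxy
    rw [slope_def_module, slope_def_field, norm_smul, norm_inv, Real.norm_of_nonneg hpos.le,
      inv_mul_eq_div, ← dist_eq_norm, dist_comm]
    gcongr
  · filter_upwards [hVG, self_mem_nhdsWithin] with y hy hxy
    have hpos : 0 < y - x := sub_pos.2 hxy
    rw [slope_def_field, slope_def_field]
    gcongr

/-- The total variation of `f` up to `x` increases at least as fast as `f` moves and at most as
fast as `G`, so it has the same right derivative as `G`. -/
lemma eVariationOn_eq_integral_of_dist_le_sub {f f' : ℝ → E} {G : ℝ → ℝ} {a b : ℝ} (hab : a ≤ b)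
    (hfG : ∀ x ∈ Icc a b, ∀ y ∈ Icc a b, x ≤ y → dist (f x) (f y) ≤ G y - G x)
    (hGc : ContinuousOn G (Icc a b))
    (hf : ∀ x ∈ Ioo a b, HasDerivWithinAt f (f' x) (Ioi x) x)
    (hG : ∀ x ∈ Ioo a b, HasDerivWithinAt G ‖f' x‖ (Ioi x) x)
    (hi : IntervalIntegrable (fun x => ‖f' x‖) volume a b) :
    eVariationOn f (Icc a b) = ENNReal.ofReal (∫ x in a..b, ‖f' x‖) := by
  have ha : a ∈ Icc a b := left_mem_Icc.2 hab
  have hbv : BoundedVariationOn f (Icc a b) := ne_top_of_le_ne_top ENNReal.ofReal_ne_top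
    (by simpa only [inter_self] using eVariationOn_inter_Icc_le hfG ha (right_mem_Icc.2 hab) hab)
  set V : ℝ → ℝ := variationOnFromTo f (Icc a b) a with V_def
  have hfV : ∀ x ∈ Icc a b, ∀ y ∈ Icc a b, x ≤ y → dist (f x) (f y) ≤ V y - V x :=
    fun x hx y hy => dist_le_variationOnFromTo_sub hbv.locallyBoundedVariationOn ha hx hy
  have hVG : ∀ x ∈ Icc a b, ∀ y ∈ Icc a b, x ≤ y → V y - V x ≤ G y - G x := by
    intro x hx y hy hxy
    rw [V_def, variationOnFromTo.sub_right hbv.locallyBoundedVariationOn ha hy hx,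
      variationOnFromTo.eq_of_le f _ hxy]
    exact ENNReal.toReal_le_of_le_ofReal (dist_nonneg.trans (hfG x hx y hy hxy))
      (eVariationOn_inter_Icc_le hfG hx hy hxy)
  have hVc : ContinuousOn V (Icc a b) := by
    refine continuousOn_of_abs_sub_le (G := G) (fun x hx y hy => ?_) hGc
    wlog hxy : x ≤ y generalizing x y
    · simpa only [abs_sub_comm] using this y hy x hx (le_of_not_ge hxy)
    rw [abs_of_nonneg (dist_nonneg.trans (hfV x hx y hy hxy))]
    exact (hVG x hx y hy hxy).trans (le_abs_self _)
  have hVd : ∀ x ∈ Ioo a b, HasDerivWithinAt V ‖f' x‖ (Ioi x) x := by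
    intro x hx
    have hev : ∀ᶠ y in 𝓝[>] x, y ∈ Icc a b ∧ x ≤ y := by
      filter_upwards [Ioo_mem_nhdsGT hx.2] with y hy
      exact ⟨⟨hx.1.le.trans hy.1.le, hy.2.le⟩, hy.1.le⟩
    have hx' := Ioo_subset_Icc_self hx
    exact hasDerivWithinAt_of_dist_le_sub_le (hf x hx) (hG x hx)
      (hev.mono fun y hy => hfV x hx' y hy.1 hy.2) (hev.mono fun y hy => hVG x hx' y hy.1 hy.2)
  rw [intervalIntegral.integral_eq_sub_of_hasDeriv_right_of_le hab hVc hVd hi, V_def,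
    variationOnFromTo.self, sub_zero, variationOnFromTo.eq_of_le f _ hab, inter_self,
    ENNReal.ofReal_toReal hbv]

theorem eVariationOn_eq_integral_norm_deriv [CompleteSpace E] {f f' : ℝ → E} {a b : ℝ}
    (hab : a ≤ b) (hf : ContinuousOn f (Icc a b)) (hd : ∀ x ∈ Ioo a b, HasDerivAt f (f' x) x)
    (hc : ContinuousOn f' (Ioo a b)) (hi : IntervalIntegrable f' volume a b) :
    eVariationOn f (Icc a b) = ENNReal.ofReal (∫ x in a..b, ‖f' x‖) := by
  have hi' : ∀ x ∈ Icc a b, ∀ y ∈ Icc a b, IntervalIntegrable f' volume x y := fun x hx y hy =>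
    hi.mono_set (by rw [uIcc_of_le hab]; exact uIcc_subset_Icc hx hy)
  have ha : a ∈ Icc a b := left_mem_Icc.2 hab
  refine eVariationOn_eq_integral_of_dist_le_sub (G := fun x => ∫ w in a..x, ‖f' w‖) hab ?_ ?_
    (fun x hx => (hd x hx).hasDerivWithinAt) (fun x hx => HasDerivAt.hasDerivWithinAt ?_) hi.norm
  · intro x hx y hy hxy
    rw [dist_comm, dist_eq_norm, ← intervalIntegral.integral_eq_sub_of_hasDerivAt_of_le hxy
      (hf.mono (Icc_subset_Icc hx.1 hy.2))
      (fun w hw => hd w ⟨hx.1.trans_lt hw.1, hw.2.trans_le hy.2⟩) (hi' x hx y hy),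
      intervalIntegral.integral_interval_sub_left (hi' a ha y hy).norm (hi' a ha x hx).norm]
    exact intervalIntegral.norm_integral_le_integral_norm hxy
  · rw [← uIcc_of_le hab]
    exact intervalIntegral.continuousOn_primitive_interval' hi.norm left_mem_uIcc
  · exact intervalIntegral.integral_hasDerivAt_right (hi' a ha x (Ioo_subset_Icc_self hx)).norm
      (hc.norm.stronglyMeasurableAtFilter isOpen_Ioo x hx)
      (hc.norm.continuousAt (Ioo_mem_nhds hx.1 hx.2))

end ArcLength

/-! ### The first variation of length -/

section FirstVariation

variable {E : Type*} [NormedAddCommGroup E] [InnerProductSpace ℝ E]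

lemma hasDerivAt_norm_add_smul {a b : E} (ha : a ≠ 0) :
    HasDerivAt (fun t : ℝ => ‖a + t • b‖) (inner ℝ a b / ‖a‖) 0 := by
  have hlin : HasDerivAt (fun t : ℝ => a + t • b) b 0 := by
    simpa using ((hasDerivAt_id (0 : ℝ)).smul_const b).const_add a
  have hsqrt := hlin.norm_sq.sqrt (by simpa using ha)
  simp only [Real.sqrt_sq (norm_nonneg _), zero_smul, add_zero] at hsqrt
  exact hsqrt.congr_deriv (mul_div_mul_left _ _ two_ne_zero)

lemma lipschitzOnWith_norm_add_smul (a b : E) (s : Set ℝ) :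
    LipschitzOnWith ‖b‖₊ (fun t : ℝ => ‖a + t • b‖) s :=
  LipschitzOnWith.of_dist_le_mul fun t _ t' _ => by
    rw [Real.dist_eq, coe_nnnorm, Real.dist_eq, mul_comm, ← Real.norm_eq_abs (t - t'), ← norm_smul,
      sub_smul, ← add_sub_add_left_eq_sub (t • b) (t' • b) a]
    exact abs_norm_sub_norm_le _ _

lemma hasDerivAt_integral_norm_add_smul {v w : ℝ → E} {a b : ℝ}
    (hv : IntervalIntegrable v volume a b) (hw : IntervalIntegrable w volume a b)
    (hne : ∀ᵐ u, u ∈ uIoc a b → v u ≠ 0) :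
    HasDerivAt (fun t : ℝ => ∫ u in a..b, ‖v u + t • w u‖)
      (∫ u in a..b, inner ℝ (v u) (w u) / ‖v u‖) 0 := by
  have hint : ∀ t : ℝ, IntervalIntegrable (fun u => ‖v u + t • w u‖) volume a b := fun t =>
    (hv.add (hw.smul t)).norm
  have hvm := hv.def'.aestronglyMeasurable
  refine (intervalIntegral.hasDerivAt_integral_of_dominated_loc_of_lip (s := univ)
    (bound := fun u => ‖w u‖) univ_mem (.of_forall fun t => (hint t).def'.aestronglyMeasurable)
    (hint 0) ?_ (.of_forall fun u _ => ?_) hw.norm ?_).2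
  · exact ((hvm.inner hw.def'.aestronglyMeasurable).aemeasurable.div
      hvm.norm.aemeasurable).aestronglyMeasurable
  · simpa using lipschitzOnWith_norm_add_smul (v u) (w u) univ
  · exact hne.mono fun u hu hu' => hasDerivAt_norm_add_smul (hu hu')

lemma intervalIntegrable_inner {f ζ : ℝ → E} {a b : ℝ} (hf : IntervalIntegrable f volume a b)
    (hζ : ContinuousOn ζ (uIcc a b)) :
    IntervalIntegrable (fun u => inner ℝ (f u) (ζ u)) volume a b := by
  obtain ⟨C, hC⟩ := isCompact_uIcc.exists_bound_of_continuousOn hζ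
  refine (hf.norm.mul_const C).mono_fun' ?_ ?_
  · exact hf.def'.aestronglyMeasurable.inner
      ((hζ.mono uIoc_subset_uIcc).aestronglyMeasurable measurableSet_uIoc)
  · filter_upwards [ae_restrict_mem measurableSet_uIoc] with u hu
    exact (norm_inner_le_norm _ _).trans
      (mul_le_mul_of_nonneg_left (hC u (uIoc_subset_uIcc hu)) (norm_nonneg _))

lemma integral_inner_deriv_eq_sub {T T' ζ ζ' : ℝ → E} {a b : ℝ} (hab : a ≤ b)
    (hT : ContinuousOn T (Icc a b)) (hTd : ∀ u ∈ Ioo a b, HasDerivAt T (T' u) u)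
    (hTi : IntervalIntegrable T' volume a b)
    (hζ : ∀ u, HasDerivAt ζ (ζ' u) u) (hζ' : Continuous ζ') :
    ∫ u in a..b, inner ℝ (T u) (ζ' u) =
      inner ℝ (T b) (ζ b) - inner ℝ (T a) (ζ a) - ∫ u in a..b, inner ℝ (T' u) (ζ u) := by
  have hζc : Continuous ζ := continuous_iff_continuousAt.2 fun u => (hζ u).continuousAt
  have hi : IntervalIntegrable (fun u => inner ℝ (T u) (ζ' u)) volume a b :=
    ContinuousOn.intervalIntegrable (by rw [uIcc_of_le hab]; exact hT.inner hζ'.continuousOn)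
  have hi' := intervalIntegrable_inner hTi hζc.continuousOn
  rw [eq_sub_iff_add_eq, ← intervalIntegral.integral_add hi hi']
  exact intervalIntegral.integral_eq_sub_of_hasDerivAt_of_le hab (hT.inner hζc.continuousOn)
    (fun u hu => (hTd u hu).inner ℝ (hζ u)) (hi.add hi')

/-- The arc `f` on `[a, b]` has speed `ρ`, unit tangent vector `T`, and curvature vector `T' / ρ`.
The speed and `T'` may be unbounded at the ends of the parameter interval. -/
structure IsRegularArc (f : ℝ → E) (ρ : ℝ → ℝ) (T T' : ℝ → E) (a b : ℝ) : Prop where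
  continuousOn : ContinuousOn f (Icc a b)
  hasDerivAt : ∀ u ∈ Ioo a b, HasDerivAt f (ρ u • T u) u
  speed_pos : ∀ u ∈ Ioo a b, 0 < ρ u
  continuousOn_speed : ContinuousOn ρ (Ioo a b)
  intervalIntegrable_speed : IntervalIntegrable ρ volume a b
  continuousOn_tangent : ContinuousOn T (Icc a b)
  norm_tangent : ∀ u ∈ Ioo a b, ‖T u‖ = 1
  hasDerivAt_tangent : ∀ u ∈ Ioo a b, HasDerivAt T (T' u) u
  intervalIntegrable_tangent : IntervalIntegrable T' volume a b

lemma isRegularArc_segment {p T : E} {v : ℝ} (hv : 0 < v) (hT : ‖T‖ = 1) (a b : ℝ) :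
    IsRegularArc (fun u => p + (v * u) • T) (fun _ => v) (fun _ => T) (fun _ => 0) a b where
  continuousOn := by fun_prop
  hasDerivAt u _ := by
    simpa using (((hasDerivAt_id u).const_mul v).smul_const T).const_add p
  speed_pos _ _ := hv
  continuousOn_speed := continuousOn_const
  intervalIntegrable_speed := intervalIntegrable_const
  continuousOn_tangent := continuousOn_const
  norm_tangent _ _ := hT
  hasDerivAt_tangent u _ := hasDerivAt_const u T
  intervalIntegrable_tangent := intervalIntegrable_const

/-- The curves `f + t ζ` on `s` are rectifiable, and their length has derivative `L` at `t = 0`. -/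
structure HasLengthVariation {α : Type*} [LinearOrder α] (f ζ : α → E) (s : Set α) (L : ℝ) :
    Prop where
  ne_top : ∀ t : ℝ, eVariationOn (fun u => f u + t • ζ u) s ≠ ⊤
  hasDerivAt : HasDerivAt (fun t : ℝ => (eVariationOn (fun u => f u + t • ζ u) s).toReal) L 0

theorem IsRegularArc.hasLengthVariation [CompleteSpace E] {f T T' ζ ζ' : ℝ → E} {ρ : ℝ → ℝ}
    {a b : ℝ} (h : IsRegularArc f ρ T T' a b) (hab : a ≤ b)
    (hζ : ∀ u, HasDerivAt ζ (ζ' u) u) (hζ' : Continuous ζ') :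
    HasLengthVariation f ζ (Icc a b)
      (inner ℝ (T b) (ζ b) - inner ℝ (T a) (ζ a) - ∫ u in a..b, inner ℝ (T' u) (ζ u)) := by
  have hζc : Continuous ζ := continuous_iff_continuousAt.2 fun u => (hζ u).continuousAt
  have hv : IntervalIntegrable (fun u => ρ u • T u) volume a b :=
    h.intervalIntegrable_speed.smul_continuousOn
      (by rw [uIcc_of_le hab]; exact h.continuousOn_tangent)
  have hlen : ∀ t : ℝ, eVariationOn (fun u => f u + t • ζ u) (Icc a b) =
      ENNReal.ofReal (∫ u in a..b, ‖ρ u • T u + t • ζ' u‖) := fun t =>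
    eVariationOn_eq_integral_norm_deriv hab (h.continuousOn.add (by fun_prop))
      (fun u hu => (h.hasDerivAt u hu).add ((hζ u).const_smul t))
      ((h.continuousOn_speed.smul (h.continuousOn_tangent.mono Ioo_subset_Icc_self)).add
        (by fun_prop))
      (hv.add ((hζ'.const_smul t).intervalIntegrable a b))
  have hIoo : ∀ᵐ u : ℝ, u ∈ uIoc a b → u ∈ Ioo a b := by
    filter_upwards [Measure.ae_ne volume b] with u hu hu'
    rw [uIoc_of_le hab] at hu'
    exact ⟨hu'.1, lt_of_le_of_ne hu'.2 hu⟩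
  refine ⟨fun t => by rw [hlen t]; exact ENNReal.ofReal_ne_top, ?_⟩
  have hnonneg : ∀ t : ℝ, 0 ≤ ∫ u in a..b, ‖ρ u • T u + t • ζ' u‖ := fun t =>
    intervalIntegral.integral_nonneg hab fun u _ => norm_nonneg _
  simp only [hlen, ENNReal.toReal_ofReal (hnonneg _)]
  refine (hasDerivAt_integral_norm_add_smul hv (hζ'.intervalIntegrable a b)
    (hIoo.mono fun u hu hu' => ?_)).congr_deriv ?_
  · exact smul_ne_zero (h.speed_pos u (hu hu')).ne'
      (norm_ne_zero_iff.1 (by rw [h.norm_tangent u (hu hu')]; exact one_ne_zero))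
  · rw [← integral_inner_deriv_eq_sub hab h.continuousOn_tangent h.hasDerivAt_tangent
      h.intervalIntegrable_tangent hζ hζ']
    refine intervalIntegral.integral_congr_ae (hIoo.mono fun u hu hu' => ?_)
    have hρ := h.speed_pos u (hu hu')
    rw [norm_smul, h.norm_tangent u (hu hu'), mul_one, Real.norm_of_nonneg hρ.le,
      real_inner_smul_left, mul_div_cancel_left₀ _ hρ.ne']

namespace HasLengthVariation

lemma of_eVariationOn_eq {F α β : Type*} [NormedAddCommGroup F] [InnerProductSpace ℝ F]
    [LinearOrder α] [LinearOrder β] {f ζ : α → E} {g η : β → F} {s : Set α} {r : Set β} {L : ℝ}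
    (h : HasLengthVariation f ζ s L)
    (heq : ∀ t : ℝ, eVariationOn (fun u => g u + t • η u) r =
      eVariationOn (fun u => f u + t • ζ u) s) :
    HasLengthVariation g η r L :=
  ⟨fun t => by rw [heq]; exact h.ne_top t, by simpa only [heq] using h.hasDerivAt⟩

lemma congr {α : Type*} [LinearOrder α] {f g ζ : α → E} {s : Set α} {L : ℝ}
    (h : HasLengthVariation f ζ s L) (hfg : EqOn f g s) : HasLengthVariation g ζ s L :=
  h.of_eVariationOn_eq fun t => eVariationOn.eq_of_eqOn fun u hu => by
    simp only [hfg hu]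

lemma append {α : Type*} [LinearOrder α] {f ζ : α → E} {a b c : α} {L L' : ℝ}
    (h : HasLengthVariation f ζ (Icc a b) L) (h' : HasLengthVariation f ζ (Icc b c) L')
    (hab : a ≤ b) (hbc : b ≤ c) : HasLengthVariation f ζ (Icc a c) (L + L') := by
  have hadd : ∀ t : ℝ, eVariationOn (fun u => f u + t • ζ u) (Icc a c) =
      eVariationOn (fun u => f u + t • ζ u) (Icc a b) +
        eVariationOn (fun u => f u + t • ζ u) (Icc b c) := fun t => by
    simpa only [univ_inter] using
      (eVariationOn.Icc_add_Icc (fun u => f u + t • ζ u) hab hbc (mem_univ b)).symm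
  refine ⟨fun t => by rw [hadd]; exact ENNReal.add_ne_top.2 ⟨h.ne_top t, h'.ne_top t⟩, ?_⟩
  simpa only [hadd, ENNReal.toReal_add (h.ne_top _) (h'.ne_top _)] using
    h.hasDerivAt.fun_add h'.hasDerivAt

lemma of_comp_lineMap {f ζ : ℝ → E} {p q L : ℝ}
    (h : HasLengthVariation (f ∘ AffineMap.lineMap p q) (ζ ∘ AffineMap.lineMap p q)
      (Icc (0 : ℝ) 1) L) :
    HasLengthVariation f ζ (uIcc p q) L := by
  refine h.of_eVariationOn_eq fun t => ?_
  rw [← segment_eq_uIcc, segment_eq_image_lineMap]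
  rcases le_total p q with hpq | hqp
  · exact (eVariationOn.comp_eq_of_monotoneOn _ _
      ((AffineMap.lineMap_mono hpq).monotoneOn _)).symm
  · exact (eVariationOn.comp_eq_of_antitoneOn _ _
      ((AffineMap.lineMap_anti hqp).antitoneOn _)).symm

lemma append_sum {α : Type*} [LinearOrder α] {f ζ : α → E} {n : ℕ} {p : ℕ → α} (hp : Monotone p)
    {L : Fin n → ℝ} (h : ∀ k : Fin n, HasLengthVariation f ζ (Icc (p k) (p (k + 1))) (L k)) :
    HasLengthVariation f ζ (Icc (p 0) (p n)) (∑ k, L k) := by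
  induction n with
  | zero =>
    exact ⟨fun t => by simp, by simpa using hasDerivAt_const (0 : ℝ) (0 : ℝ)⟩
  | succ n ih =>
    rw [Fin.sum_univ_castSucc]
    exact (ih fun k => h k.castSucc).append (h (Fin.last n)) (hp n.zero_le) (hp n.le_succ)

lemma comp_linearIsometry {F α : Type*} [NormedAddCommGroup F] [InnerProductSpace ℝ F]
    [LinearOrder α] {f ζ : α → E} {s : Set α} {L : ℝ} (h : HasLengthVariation f ζ s L)
    (φ : E →ₗᵢ[ℝ] F) : HasLengthVariation (fun u => φ (f u)) (fun u => φ (ζ u)) s L :=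
  h.of_eVariationOn_eq fun t => by
    simp only [← map_smul, ← map_add, eVariationOn, φ.isometry.edist_eq]

lemma comp_coe_unitInterval {f ζ : ℝ → E} {L : ℝ} (h : HasLengthVariation f ζ (Icc 0 1) L) :
    HasLengthVariation (fun s : I => f s) (fun s : I => ζ s) univ L :=
  h.of_eVariationOn_eq fun t => by
    have hcomp := eVariationOn.comp_eq_of_monotoneOn (fun u => f u + t • ζ u) (t := univ)
      (fun s : I => (s : ℝ)) fun _ _ _ _ hst => hst
    rwa [image_univ, Subtype.range_coe] at hcomp

end HasLengthVariation

end FirstVariation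

theorem isFirstVariationOfLen_sum {ι : Type} [Fintype ι] {γ : ι → I → E3}
    {F : ι → C(I, E3) →L[ℝ] ℝ}
    (h : ∀ i (ζ : C(I, E3)) (f : ℝ → E3), ContDiff ℝ 1 f → (∀ s : I, ζ s = f s) →
      HasLengthVariation (γ i) ζ univ (F i ζ)) :
    IsFirstVariationOfLen γ (∑ i, F i ∘L ContinuousLinearMap.proj i) := by
  refine ⟨fun i => ?_, fun ξ hξ => ?_⟩
  · simpa using (h i 0 (fun _ => 0) contDiff_const fun _ => rfl).ne_top 0
  · choose f hf hξf using hξ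
    refine (HasDerivAt.fun_sum fun i _ =>
      (h i (ξ i) (f i) (hf i) (hξf i)).hasDerivAt).congr_deriv ?_
    simp

/-! ### The one-sided variation of a minimum -/

section Danskin

variable {K : Type*} [TopologicalSpace K] [CompactSpace K]

/-- Near a minimizer of `φ` the bound comes from `D k > c`, and away from the minimizers from
`φ k > m`; compactness makes the range of `t` uniform. -/
lemma eventually_forall_add_mul_le {φ D : K → ℝ} (hφ : Continuous φ) (hD : Continuous D)
    {m c : ℝ} (hm : ∀ k, m ≤ φ k) (hc : ∀ k, φ k = m → c < D k) :
    ∀ᶠ t in 𝓝[≥] (0 : ℝ), ∀ k, m + t * c ≤ φ k + t * D k := by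
  have hloc : ∀ k ∈ (univ : Set K), ∀ᶠ z : ℝ × K in 𝓝 (0, k),
      0 ≤ z.1 → m + z.1 * c ≤ φ z.2 + z.1 * D z.2 := by
    intro k _
    rcases (hm k).eq_or_lt with hk | hk
    · have hnear : ∀ᶠ z : ℝ × K in 𝓝 (0, k), c < D z.2 :=
        (continuous_const.tendsto _).eventually_lt ((hD.comp continuous_snd).tendsto _)
          (hc k hk.symm)
      filter_upwards [hnear] with z hz hz0
      exact add_le_add (hm z.2) (mul_le_mul_of_nonneg_left hz.le hz0)
    · have hnear : ∀ᶠ z : ℝ × K in 𝓝 (0, k), m + z.1 * c < φ z.2 + z.1 * D z.2 :=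
        (Continuous.tendsto (by fun_prop) _).eventually_lt (Continuous.tendsto (by fun_prop) _)
          (by simpa using hk)
      exact hnear.mono fun z hz _ => hz.le
  filter_upwards [nhdsWithin_le_nhds (isCompact_univ.eventually_forall_of_forall_eventually
    (P := fun t k => 0 ≤ t → m + t * c ≤ φ k + t * D k) hloc), self_mem_nhdsWithin]
    with t ht ht0 k using ht k (mem_univ k) ht0

/-- Danskin's theorem. -/
theorem exists_hasDerivWithinAt_iInf [Nonempty K] {φ : ℝ → K → ℝ} {D : K → ℝ}
    (hφ : Continuous (φ 0)) (hD : Continuous D)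
    (h : ∀ ε > 0, ∀ᶠ t in 𝓝[≥] (0 : ℝ), ∀ k, |φ t k - φ 0 k - t * D k| ≤ ε * t) :
    ∃ k₀, (∀ k, φ 0 k₀ ≤ φ 0 k) ∧ (∀ k, (∀ k', φ 0 k ≤ φ 0 k') → D k₀ ≤ D k) ∧
      HasDerivWithinAt (fun t => ⨅ k, φ t k) (D k₀) (Ici 0) 0 := by
  obtain ⟨k₁, -, hk₁⟩ := isCompact_univ.exists_isMinOn univ_nonempty hφ.continuousOn
  have hmin : ∀ k, φ 0 k₁ ≤ φ 0 k := fun k => hk₁ (mem_univ k)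
  have hcpt : IsCompact {k | φ 0 k ≤ φ 0 k₁} := (isClosed_le hφ continuous_const).isCompact
  obtain ⟨k₀, hk₀ : φ 0 k₀ ≤ φ 0 k₁, hDmin⟩ :=
    hcpt.exists_isMinOn ⟨k₁, le_refl (φ 0 k₁)⟩ hD.continuousOn
  have hm : ∀ k, φ 0 k₀ ≤ φ 0 k := fun k => hk₀.trans (hmin k)
  have hDm : ∀ k, φ 0 k ≤ φ 0 k₁ → D k₀ ≤ D k := fun k hk => hDmin hk
  refine ⟨k₀, hm, fun k hk => hDm k (hk k₁), ?_⟩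
  rw [hasDerivWithinAt_iff_isLittleO, Asymptotics.isLittleO_iff]
  intro ε hε
  have hlow := eventually_forall_add_mul_le (c := D k₀ - ε / 2) hφ hD hm fun k hk =>
    (sub_lt_self _ (half_pos hε)).trans_le (hDm k (hk.trans_le hk₀))
  filter_upwards [hlow, h (ε / 2) (half_pos hε), self_mem_nhdsWithin] with t hlow ht ht0
  have ht0 : 0 ≤ t := ht0
  have hbelow : ∀ k, φ 0 k₀ + t * D k₀ - ε * t ≤ φ t k := fun k => by
    linarith [hlow k, (abs_le.1 (ht k)).1]
  have hle : ⨅ k, φ t k ≤ φ 0 k₀ + t * D k₀ + ε / 2 * t :=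
    (ciInf_le ⟨_, forall_mem_range.2 hbelow⟩ k₀).trans (by linarith [(abs_le.1 (ht k₀)).2])
  have hge : φ 0 k₀ + t * D k₀ - ε * t ≤ ⨅ k, φ t k := le_ciInf hbelow
  have h0 : ⨅ k, φ 0 k = φ 0 k₀ :=
    le_antisymm (ciInf_le ⟨_, forall_mem_range.2 hm⟩ k₀) (le_ciInf hm)
  rw [h0, sub_zero, smul_eq_mul, Real.norm_eq_abs, Real.norm_eq_abs, abs_of_nonneg ht0, abs_le]
  have := mul_nonneg hε.le ht0
  constructor <;> linarith

lemma abs_norm_add_sub_le {E : Type*} [NormedAddCommGroup E] [InnerProductSpace ℝ E]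
    {a : E} (ha : a ≠ 0) (b : E) :
    |‖a + b‖ - ‖a‖ - inner ℝ a b / ‖a‖| ≤ ‖b‖ ^ 2 / (2 * ‖a‖) := by
  have hpos : 0 < ‖a‖ := norm_pos_iff.2 ha
  have hsq := norm_add_sq_real a b
  have hcs : ‖a‖ ^ 2 + inner ℝ a b ≤ ‖a‖ * ‖a + b‖ := by
    simpa only [inner_add_right, real_inner_self_eq_norm_sq] using real_inner_le_norm a (a + b)
  have hquot : ‖a + b‖ - ‖a‖ - inner ℝ a b / ‖a‖ =
      (‖a‖ * ‖a + b‖ - (‖a‖ ^ 2 + inner ℝ a b)) / ‖a‖ := by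
    field_simp
    ring
  rw [hquot, abs_of_nonneg (div_nonneg (sub_nonneg.2 hcs) hpos.le), ← div_div,
    div_le_div_iff_of_pos_right hpos]
  linarith [sq_nonneg (‖a + b‖ - ‖a‖)]

theorem exists_hasDerivWithinAt_iInf_norm [Nonempty K] {E : Type*} [NormedAddCommGroup E]
    [InnerProductSpace ℝ E] {A B : K → E} (hA : Continuous A) (hB : Continuous B)
    (hne : ∀ k, A k ≠ 0) :
    ∃ a, HasDerivWithinAt (fun t : ℝ => ⨅ k, ‖A k + t • B k‖) a (Ici 0) 0 ∧
      ∀ k, (∀ k', ‖A k‖ ≤ ‖A k'‖) → a ≤ inner ℝ (A k) (B k) / ‖A k‖ := by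
  have hnorm : ∀ k, ‖A k‖ ≠ 0 := fun k => norm_ne_zero_iff.2 (hne k)
  have hC : Continuous fun k => ‖B k‖ ^ 2 / (2 * ‖A k‖) :=
    (hB.norm.pow 2).div (by fun_prop) fun k => mul_ne_zero two_ne_zero (hnorm k)
  obtain ⟨C, hC⟩ := isCompact_univ.exists_bound_of_continuousOn hC.continuousOn
  have hquad : ∀ t : ℝ, 0 ≤ t → ∀ k,
      |‖A k + t • B k‖ - ‖A k‖ - t * (inner ℝ (A k) (B k) / ‖A k‖)| ≤ t * (t * C) := by
    intro t ht k
    have hbound := abs_norm_add_sub_le (hne k) (t • B k)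
    rw [inner_smul_right, mul_div_assoc, norm_smul, mul_pow, mul_div_assoc, Real.norm_eq_abs,
      sq_abs, sq, mul_assoc] at hbound
    refine hbound.trans ?_
    gcongr
    exact (le_abs_self _).trans (hC k (mem_univ k))
  have hunif : ∀ ε > 0, ∀ᶠ t in 𝓝[≥] (0 : ℝ), ∀ k,
      |‖A k + t • B k‖ - ‖A k + (0 : ℝ) • B k‖ - t * (inner ℝ (A k) (B k) / ‖A k‖)| ≤ ε * t := by
    intro ε hε
    have hsmall : ∀ᶠ t in 𝓝[≥] (0 : ℝ), t * C < ε :=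
      nhdsWithin_le_nhds ((Continuous.tendsto (by fun_prop) _).eventually_lt
        tendsto_const_nhds (by simpa using hε))
    filter_upwards [hsmall, self_mem_nhdsWithin] with t ht ht0 k
    rw [zero_smul, add_zero, mul_comm ε]
    exact (hquad t ht0 k).trans (mul_le_mul_of_nonneg_left ht.le ht0)
  obtain ⟨k₀, -, hk₀, hder⟩ := exists_hasDerivWithinAt_iInf (φ := fun t k => ‖A k + t • B k‖)
    (by simpa using hA.norm) ((hA.inner hB).div hA.norm hnorm) hunif
  exact ⟨_, hder, fun k hk => hk₀ k (by simpa using hk)⟩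

end Danskin

/-! ### Thickness and obstacles -/

lemma gThi_fin_two (γ : Fin 2 → I → E3) : gThi γ = ⨅ k : I × I, ‖γ 0 k.1 - γ 1 k.2‖ := by
  refine congrArg sInf (Set.ext fun r => ⟨?_, ?_⟩)
  · rintro ⟨i, j, hij, s, t, rfl⟩
    fin_cases i <;> fin_cases j
    · exact absurd rfl hij
    · exact ⟨(s, t), (dist_eq_norm _ _).symm⟩
    · exact ⟨(t, s), ((dist_comm _ _).trans (dist_eq_norm _ _)).symm⟩
    · exact absurd rfl hij
  · rintro ⟨⟨s, t⟩, rfl⟩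
    exact ⟨0, 1, Fin.zero_ne_one, s, t, (dist_eq_norm _ _).symm⟩

lemma obst_eq_iInf {ι J : Type} (g : J → E3 → ℝ) (γ : ι → I → E3) :
    obst g γ = ⨅ k : J × ι × I, g k.1 (γ k.2.1 k.2.2) := by
  refine congrArg sInf (Set.ext fun r => ⟨?_, ?_⟩)
  · rintro ⟨j, i, s, rfl⟩
    exact ⟨(j, i, s), rfl⟩
  · rintro ⟨⟨j, i, s⟩, rfl⟩
    exact ⟨j, i, s, rfl⟩

theorem exists_hasDerivWithinAt_gThi {γ : Fin 2 → I → E3} (hγ : ∀ i, Continuous (γ i))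
    (hne : ∀ s t, γ 0 s ≠ γ 1 t) (ξ : Fin 2 → C(I, E3)) :
    ∃ a, HasDerivWithinAt (fun t : ℝ => gThi (move γ ξ t)) a (Ici 0) 0 ∧
      ∀ s t, ‖γ 0 s - γ 1 t‖ = gThi γ → a ≤ inner ℝ (γ 0 s - γ 1 t) (ξ 0 s - ξ 1 t) / gThi γ := by
  obtain ⟨a, ha, hmin⟩ := exists_hasDerivWithinAt_iInf_norm (K := I × I)
    (A := fun k => γ 0 k.1 - γ 1 k.2) (B := fun k => ξ 0 k.1 - ξ 1 k.2)
    (((hγ 0).comp continuous_fst).sub ((hγ 1).comp continuous_snd)) (by fun_prop)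
    fun k => sub_ne_zero.2 (hne k.1 k.2)
  refine ⟨a, ?_, fun s t hst => ?_⟩
  · have hmove : ∀ t : ℝ, gThi (move γ ξ t) =
        ⨅ k : I × I, ‖γ 0 k.1 - γ 1 k.2 + t • (ξ 0 k.1 - ξ 1 k.2)‖ := fun t => by
      simp only [gThi_fin_two, move, smul_sub, add_sub_add_comm]
    simpa only [hmove] using ha
  · have hle := hmin (s, t) fun k' => by
      rw [hst, gThi_fin_two]
      exact ciInf_le ⟨0, forall_mem_range.2 fun _ => norm_nonneg _⟩ k'
    rwa [hst] at hle

theorem exists_hasDerivWithinAt_obst {ι J : Type} [Finite ι] [Finite J] [Nonempty ι] [Nonempty J]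
    (c : J → ℝ) (ℓ : J → E3 →L[ℝ] ℝ) {γ : ι → I → E3} (hγ : ∀ i, Continuous (γ i))
    (ξ : ι → C(I, E3)) :
    ∃ b, HasDerivWithinAt (fun t : ℝ => obst (fun j q => c j + ℓ j q) (move γ ξ t)) b
      (Ici 0) 0 := by
  let _ : TopologicalSpace ι := ⊥
  let _ : TopologicalSpace J := ⊥
  have : DiscreteTopology ι := ⟨rfl⟩
  have : DiscreteTopology J := ⟨rfl⟩
  have hcont : ∀ δ : ι → I → E3, (∀ i, Continuous (δ i)) →
      Continuous fun k : J × ι × I => ℓ k.1 (δ k.2.1 k.2.2) := fun δ hδ =>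
    continuous_prod_of_discrete_left.2 fun j => continuous_prod_of_discrete_left.2 fun i =>
      (ℓ j).continuous.comp (hδ i)
  have hcont₀ : Continuous fun k : J × ι × I => c k.1 + ℓ k.1 (move γ ξ 0 k.2.1 k.2.2) :=
    ((continuous_of_discreteTopology (f := c)).comp continuous_fst).add
      (hcont _ fun i => (hγ i).add ((ξ i).continuous.const_smul (0 : ℝ)))
  obtain ⟨k₀, -, -, hder⟩ := exists_hasDerivWithinAt_iInf
    (φ := fun t (k : J × ι × I) => c k.1 + ℓ k.1 (move γ ξ t k.2.1 k.2.2))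
    hcont₀ (hcont (fun i s => ξ i s) fun i => (ξ i).continuous) fun ε hε => by
      filter_upwards [self_mem_nhdsWithin] with t ht k
      simpa [move] using mul_nonneg hε.le ht
  exact ⟨_, by simpa only [obst_eq_iInf] using hder⟩

/-! ### Coordinates and concatenation -/

section Coordinates

variable {X : Type*} [TopologicalSpace X]

lemma continuousOn_vec {f g h : X → ℝ} {s : Set X} (hf : ContinuousOn f s)
    (hg : ContinuousOn g s) (hh : ContinuousOn h s) :
    ContinuousOn (fun t => (!₂[f t, g t, h t] : E3)) s :=
  (PiLp.continuous_toLp 2 _).comp_continuousOn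
    (continuousOn_pi.2 (by simp [Fin.forall_fin_succ, hf, hg, hh]))

lemma continuous_vec {f g h : X → ℝ} (hf : Continuous f) (hg : Continuous g)
    (hh : Continuous h) : Continuous fun t => (!₂[f t, g t, h t] : E3) :=
  (PiLp.continuous_toLp 2 _).comp (continuous_pi (by simp [Fin.forall_fin_succ, hf, hg, hh]))

lemma hasDerivAt_vec {f g h : ℝ → ℝ} {f' g' h' t : ℝ} (hf : HasDerivAt f f' t)
    (hg : HasDerivAt g g' t) (hh : HasDerivAt h h' t) :
    HasDerivAt (fun t => (!₂[f t, g t, h t] : E3)) !₂[f', g', h'] t := by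
  have hpi : HasDerivAt (fun t => (![f t, g t, h t] : Fin 3 → ℝ)) ![f', g', h'] t :=
    hasDerivAt_pi.2 (by simp [Fin.forall_fin_succ, hf, hg, hh])
  exact (PiLp.continuousLinearEquiv 2 ℝ fun _ : Fin 3 => ℝ).symm.hasFDerivAt.comp_hasDerivAt t hpi

lemma norm_vec_sq (q : E3) : ‖q‖ ^ 2 = q 0 ^ 2 + q 1 ^ 2 + q 2 ^ 2 := by
  simp [EuclideanSpace.norm_sq_eq, Fin.sum_univ_three]

lemma inner_vec (p q : E3) : inner ℝ p q = p 0 * q 0 + p 1 * q 1 + p 2 * q 2 := by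
  simp [PiLp.inner_apply, Fin.sum_univ_three, mul_comm]

lemma vec_ext {p q : E3} (h0 : p 0 = q 0) (h1 : p 1 = q 1) (h2 : p 2 = q 2) : p = q :=
  PiLp.ext (by simp [Fin.forall_fin_succ, h0, h1, h2])

lemma intervalIntegrable_vec {f g h : ℝ → ℝ} {a b : ℝ} (hf : IntervalIntegrable f volume a b)
    (hg : IntervalIntegrable g volume a b) (hh : IntervalIntegrable h volume a b) :
    IntervalIntegrable (fun t => (!₂[f t, g t, h t] : E3)) volume a b := by
  have hsum : (fun t => (!₂[f t, g t, h t] : E3)) =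
      fun t => f t • (!₂[1, 0, 0] : E3) + g t • (!₂[0, 1, 0] : E3) + h t • (!₂[0, 0, 1] : E3) := by
    funext t
    refine vec_ext ?_ ?_ ?_ <;> simp
  rw [hsum]
  exact ((hf.smul_continuousOn continuousOn_const).add
    (hg.smul_continuousOn continuousOn_const)).add (hh.smul_continuousOn continuousOn_const)

lemma continuousOn_Icc_append {f : ℝ → X} {a b c : ℝ} (hab : a ≤ b) (hbc : b ≤ c)
    (h₁ : ContinuousOn f (Icc a b)) (h₂ : ContinuousOn f (Icc b c)) :
    ContinuousOn f (Icc a c) := by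
  rw [← Icc_union_Icc_eq_Icc hab hbc]
  exact h₁.union_of_isClosed h₂ isClosed_Icc isClosed_Icc

lemma strictMonoOn_Icc_append {f : ℝ → ℝ} {a b c : ℝ} (hab : a ≤ b) (hbc : b ≤ c)
    (h₁ : StrictMonoOn f (Icc a b)) (h₂ : StrictMonoOn f (Icc b c)) :
    StrictMonoOn f (Icc a c) := by
  rw [← Icc_union_Icc_eq_Icc hab hbc]
  exact h₁.union h₂ (isGreatest_Icc hab) (isLeast_Icc hbc)

end Coordinates

/-! ### The clasp arc -/

/-- Slope `dz/dx` of the clasp arc at parameter `u`. -/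
def claspSlope (u : ℝ) : ℝ := u / Real.sqrt (1 - u ^ 2)

/-- Vertical component of the strut that ends at parameter `u` of a clasp arc. -/
def gap (u : ℝ) : ℝ :=
  Real.sqrt ((1 - u ^ 2) * (1 - (1 - u) ^ 2) / (1 - u ^ 2 * (1 - u) ^ 2))

lemma clasp_denom_pos {u : ℝ} (hu : u ∈ Icc (0 : ℝ) 1) : 0 < 1 - u ^ 2 * (1 - u) ^ 2 := by
  obtain ⟨h0, h1⟩ := hu
  have h : u * (1 - u) ≤ 1 / 4 := by nlinarith [sq_nonneg (u - 1 / 2)]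
  have h' : 0 ≤ u * (1 - u) := mul_nonneg h0 (by linarith)
  nlinarith

lemma claspX_nonneg (u : ℝ) : 0 ≤ claspX u := Real.sqrt_nonneg _

lemma gap_nonneg (u : ℝ) : 0 ≤ gap u := Real.sqrt_nonneg _

lemma claspX_zero : claspX 0 = 0 := by simp [claspX]

lemma claspX_one : claspX 1 = 1 := by simp [claspX]

lemma claspZ_zero : claspZ 0 = 0 := by simp [claspZ]

lemma gap_one_sub (u : ℝ) : gap (1 - u) = gap u := by
  unfold gap
  congr 1
  ring_nf

lemma clasp_radicand_nonneg {u : ℝ} (hu : u ∈ Icc (0 : ℝ) 1) :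
    0 ≤ u ^ 2 * (1 - (1 - u) ^ 2) / (1 - u ^ 2 * (1 - u) ^ 2) := by
  have := clasp_denom_pos hu
  obtain ⟨h0, h1⟩ := hu
  have : 0 ≤ 1 - (1 - u) ^ 2 := by nlinarith
  positivity

lemma claspX_sq {u : ℝ} (hu : u ∈ Icc (0 : ℝ) 1) :
    claspX u ^ 2 = u ^ 2 * (1 - (1 - u) ^ 2) / (1 - u ^ 2 * (1 - u) ^ 2) :=
  Real.sq_sqrt (clasp_radicand_nonneg hu)

lemma gap_sq {u : ℝ} (hu : u ∈ Icc (0 : ℝ) 1) :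
    gap u ^ 2 = (1 - u ^ 2) * (1 - (1 - u) ^ 2) / (1 - u ^ 2 * (1 - u) ^ 2) := by
  have := clasp_denom_pos hu
  obtain ⟨h0, h1⟩ := hu
  have h2 : 0 ≤ 1 - (1 - u) ^ 2 := by nlinarith
  have h3 : 0 ≤ 1 - u ^ 2 := by nlinarith
  exact Real.sq_sqrt (by positivity)

lemma strut_sq {u : ℝ} (hu : u ∈ Icc (0 : ℝ) 1) :
    claspX u ^ 2 + claspX (1 - u) ^ 2 + gap u ^ 2 = 1 := by
  have h := clasp_denom_pos hu
  rw [claspX_sq hu, claspX_sq (Icc.one_sub_mem hu), gap_sq hu]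
  have e : 1 - (1 - u) ^ 2 * (1 - (1 - u)) ^ 2 = 1 - u ^ 2 * (1 - u) ^ 2 := by ring
  rw [e]
  field_simp
  ring

lemma sqrt_one_sub_sq_pos {u : ℝ} (hu : u ∈ Ioo (0 : ℝ) 1) : 0 < Real.sqrt (1 - u ^ 2) :=
  Real.sqrt_pos.2 (by nlinarith [hu.1, hu.2])

lemma claspSlope_pos {u : ℝ} (hu : u ∈ Ioo (0 : ℝ) 1) : 0 < claspSlope u :=
  div_pos hu.1 (sqrt_one_sub_sq_pos hu)

lemma gap_pos {u : ℝ} (hu : u ∈ Ioo (0 : ℝ) 1) : 0 < gap u := by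
  have hdenom := clasp_denom_pos (Ioo_subset_Icc_self hu)
  have hu' := Real.sqrt_pos.1 (sqrt_one_sub_sq_pos hu)
  have hv' := Real.sqrt_pos.1 (sqrt_one_sub_sq_pos (Ioo.one_sub_mem hu))
  exact Real.sqrt_pos.2 (by positivity)

lemma claspX_eq_gap_mul_claspSlope {u : ℝ} (hu : u ∈ Ioo (0 : ℝ) 1) :
    claspX u = gap u * claspSlope u := by
  have hslope := claspSlope_pos hu
  have hgap := gap_pos hu
  have hdenom := clasp_denom_pos (Ioo_subset_Icc_self hu)
  have hpos := Real.sqrt_pos.1 (sqrt_one_sub_sq_pos hu)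
  refine (sq_eq_sq₀ (claspX_nonneg u) (by positivity)).1 ?_
  rw [mul_pow, claspX_sq (Ioo_subset_Icc_self hu), gap_sq (Ioo_subset_Icc_self hu),
    claspSlope, div_pow, Real.sq_sqrt hpos.le]
  field_simp

lemma claspX_pos {u : ℝ} (hu : u ∈ Ioc (0 : ℝ) 1) : 0 < claspX u := by
  have h := clasp_denom_pos (Ioc_subset_Icc_self hu)
  obtain ⟨h0, h1⟩ := hu
  have h2 : 0 < 1 - (1 - u) ^ 2 := by nlinarith
  exact Real.sqrt_pos.2 (by positivity)

lemma continuousOn_claspX : ContinuousOn claspX (Icc 0 1) := by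
  refine Real.continuous_sqrt.comp_continuousOn (ContinuousOn.div (by fun_prop) (by fun_prop) ?_)
  exact fun u hu => (clasp_denom_pos hu).ne'

lemma continuousOn_gap : ContinuousOn gap (Icc 0 1) := by
  refine Real.continuous_sqrt.comp_continuousOn (ContinuousOn.div (by fun_prop) (by fun_prop) ?_)
  exact fun u hu => (clasp_denom_pos hu).ne'

/-- Derivative of the radicand in `claspX`, in a form that shows that it is positive. -/
def claspRadicandDeriv (u : ℝ) : ℝ :=
  2 * u ^ 2 * ((3 - 2 * u) * (1 - u ^ 2 * (1 - u) ^ 2) - u ^ 2 * (2 - u) * ((1 - u) * (2 * u - 1)))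
    / (1 - u ^ 2 * (1 - u) ^ 2) ^ 2

lemma claspRadicandDeriv_pos {u : ℝ} (hu : u ∈ Ioo (0 : ℝ) 1) : 0 < claspRadicandDeriv u := by
  have hdenom := clasp_denom_pos (Ioo_subset_Icc_self hu)
  obtain ⟨h0, h1⟩ := hu
  have hprod : u * (1 - u) ≤ 1 / 4 := by nlinarith [sq_nonneg (u - 1 / 2)]
  have hprod0 : 0 ≤ u * (1 - u) := mul_nonneg h0.le (by linarith)
  have hdenom' : 15 / 16 ≤ 1 - u ^ 2 * (1 - u) ^ 2 := by nlinarith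
  have hpos : 15 / 16 ≤ (3 - 2 * u) * (1 - u ^ 2 * (1 - u) ^ 2) := by nlinarith
  have hle : (1 - u) * (2 * u - 1) ≤ 1 / 8 := by nlinarith [sq_nonneg (u - 3 / 4)]
  have hfactor : u ^ 2 * (2 - u) ≤ 2 := by nlinarith [mul_nonneg h0.le h0.le]
  have hfactor0 : 0 ≤ u ^ 2 * (2 - u) := mul_nonneg (by positivity) (by linarith)
  refine div_pos (mul_pos (by positivity) ?_) (by positivity)
  linarith [mul_le_mul_of_nonneg_left hle hfactor0, hpos]

lemma hasDerivAt_claspX {u : ℝ} (hu : u ∈ Ioc (0 : ℝ) 1) :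
    HasDerivAt claspX (claspRadicandDeriv u / (2 * claspX u)) u := by
  have hsub : HasDerivAt (fun u : ℝ => (1 - u) ^ 2) (-(2 * (1 - u))) u := by
    simpa using ((hasDerivAt_id u).const_sub 1).fun_pow 2
  have hsq : HasDerivAt (fun u : ℝ => u ^ 2) (2 * u) u := by simpa using hasDerivAt_pow 2 u
  have hnum : HasDerivAt (fun u : ℝ => u ^ 2 * (1 - (1 - u) ^ 2)) (6 * u ^ 2 - 4 * u ^ 3) u :=
    (hsq.fun_mul (hsub.const_sub 1)).congr_deriv (by ring)
  have hden : HasDerivAt (fun u : ℝ => 1 - u ^ 2 * (1 - u) ^ 2)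
      (-(2 * u * (1 - u) * (1 - 2 * u))) u :=
    ((hsq.fun_mul hsub).const_sub 1).congr_deriv (by ring)
  have hsqrt := (hnum.fun_div hden (clasp_denom_pos (Ioc_subset_Icc_self hu)).ne').sqrt
    (Real.sqrt_pos.1 (claspX_pos hu)).ne'
  refine hsqrt.congr_deriv ?_
  unfold claspRadicandDeriv claspX
  congr 2
  ring

lemma differentiableAt_claspX {u : ℝ} (hu : u ∈ Ioo (0 : ℝ) 1) : DifferentiableAt ℝ claspX u :=
  (hasDerivAt_claspX (Ioo_subset_Ioc_self hu)).differentiableAt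

lemma deriv_claspX {u : ℝ} (hu : u ∈ Ioc (0 : ℝ) 1) :
    deriv claspX u = claspRadicandDeriv u / (2 * claspX u) :=
  (hasDerivAt_claspX hu).deriv

lemma deriv_claspX_pos {u : ℝ} (hu : u ∈ Ioo (0 : ℝ) 1) : 0 < deriv claspX u := by
  rw [deriv_claspX (Ioo_subset_Ioc_self hu)]
  have := claspX_pos (Ioo_subset_Ioc_self hu)
  have := claspRadicandDeriv_pos hu
  positivity

lemma continuousOn_deriv_claspX : ContinuousOn (deriv claspX) (Ioc 0 1) := by
  have : ContinuousOn (fun u => claspRadicandDeriv u / (2 * claspX u)) (Ioc 0 1) := by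
    refine ContinuousOn.div (ContinuousOn.div (by fun_prop) (by fun_prop) ?_)
      (continuousOn_const.mul (continuousOn_claspX.mono Ioc_subset_Icc_self)) ?_
    · exact fun u hu => pow_ne_zero _ (clasp_denom_pos (Ioc_subset_Icc_self hu)).ne'
    · exact fun u hu => (mul_pos two_pos (claspX_pos hu)).ne'
  exact this.congr fun u hu => deriv_claspX hu

lemma hasDerivAt_sqrt_one_sub_sq {u : ℝ} (hu : u ∈ Ioo (0 : ℝ) 1) :
    HasDerivAt (fun u : ℝ => Real.sqrt (1 - u ^ 2)) (-claspSlope u) u := by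
  have hne : 1 - u ^ 2 ≠ 0 := (Real.sqrt_pos.1 (sqrt_one_sub_sq_pos hu)).ne'
  refine (((hasDerivAt_pow 2 u).const_sub 1).sqrt hne).congr_deriv ?_
  rw [claspSlope]
  push_cast
  field_simp

lemma intervalIntegrable_claspSlope : IntervalIntegrable claspSlope volume 0 1 := by
  refine intervalIntegral.intervalIntegrable_deriv_of_nonneg
    (g := fun u => -Real.sqrt (1 - u ^ 2)) (by fun_prop) ?_ ?_
  · intro u hu
    exact (hasDerivAt_sqrt_one_sub_sq (by simpa using hu)).fun_neg.congr_deriv (neg_neg _)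
  · intro u hu
    exact (claspSlope_pos (by simpa using hu)).le

lemma continuousOn_claspSlope : ContinuousOn claspSlope (Ioo 0 1) :=
  ContinuousOn.div (by fun_prop) (by fun_prop) fun _ hu => (sqrt_one_sub_sq_pos hu).ne'

lemma intervalIntegrable_deriv_claspX : IntervalIntegrable (deriv claspX) volume 0 1 := by
  refine intervalIntegral.intervalIntegrable_deriv_of_nonneg
    (g := claspX) (by simpa using continuousOn_claspX) ?_ ?_
  · intro u hu
    exact (differentiableAt_claspX (by simpa using hu)).hasDerivAt
  · intro u hu
    exact (deriv_claspX_pos (by simpa using hu)).le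

lemma intervalIntegrable_deriv_claspZ :
    IntervalIntegrable (fun w => claspSlope w * deriv claspX w) volume 0 1 := by
  refine IntervalIntegrable.trans (b := 1 / 2) ?_ ?_
  · refine (intervalIntegrable_deriv_claspX.mono_set ?_).continuousOn_mul ?_
    · rw [uIcc_of_le (by norm_num), uIcc_of_le (by norm_num)]
      exact Icc_subset_Icc_right (by norm_num)
    · rw [uIcc_of_le (by norm_num)]
      refine ContinuousOn.div (by fun_prop) (by fun_prop) fun u hu => ?_
      exact (Real.sqrt_pos.2 (by nlinarith [hu.1, hu.2])).ne'
  · refine (intervalIntegrable_claspSlope.mono_set ?_).mul_continuousOn ?_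
    · rw [uIcc_of_le (by norm_num), uIcc_of_le (by norm_num)]
      exact Icc_subset_Icc_left (by norm_num)
    · rw [uIcc_of_le (by norm_num)]
      exact continuousOn_deriv_claspX.mono fun u hu => ⟨by linarith [hu.1], hu.2⟩

lemma hasDerivAt_claspZ {u : ℝ} (hu : u ∈ Ioo (0 : ℝ) 1) :
    HasDerivAt claspZ (claspSlope u * deriv claspX u) u := by
  have hc : ContinuousOn (fun w => claspSlope w * deriv claspX w) (Ioo 0 1) :=
    continuousOn_claspSlope.mul (continuousOn_deriv_claspX.mono Ioo_subset_Ioc_self)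
  refine intervalIntegral.integral_hasDerivAt_right
    (intervalIntegrable_deriv_claspZ.mono_set ?_) ?_ (hc.continuousAt (Ioo_mem_nhds hu.1 hu.2))
  · rw [uIcc_of_le hu.1.le, uIcc_of_le zero_le_one]
    exact Icc_subset_Icc_right hu.2.le
  · exact hc.stronglyMeasurableAtFilter isOpen_Ioo u hu

lemma continuousOn_claspZ : ContinuousOn claspZ (Icc 0 1) := by
  have := intervalIntegral.continuousOn_primitive_interval' intervalIntegrable_deriv_claspZ
    (a := 0) (by simp)
  rwa [uIcc_of_le zero_le_one] at this

lemma strictMonoOn_claspZ : StrictMonoOn claspZ (Icc 0 1) := by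
  refine strictMonoOn_of_deriv_pos (convex_Icc 0 1) continuousOn_claspZ fun u hu => ?_
  rw [interior_Icc] at hu
  rw [(hasDerivAt_claspZ hu).deriv]
  exact mul_pos (claspSlope_pos hu) (deriv_claspX_pos hu)

lemma claspZ_nonneg {u : ℝ} (hu : u ∈ Icc (0 : ℝ) 1) : 0 ≤ claspZ u := by
  rw [← claspZ_zero]
  exact strictMonoOn_claspZ.monotoneOn (by simp) hu hu.1

lemma claspZ_le_claspH {u : ℝ} (hu : u ∈ Icc (0 : ℝ) 1) : claspZ u ≤ claspH :=
  strictMonoOn_claspZ.monotoneOn hu (by simp) hu.2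

lemma gap_eq_sqrt {u : ℝ} (hu : u ∈ Icc (0 : ℝ) 1) :
    gap u = Real.sqrt (1 - claspX u ^ 2 - claspX (1 - u) ^ 2) := by
  rw [← Real.sqrt_sq (gap_nonneg u)]
  congr 1
  linarith [strut_sq hu]

lemma hasDerivAt_gap {u : ℝ} (hu : u ∈ Ioo (0 : ℝ) 1) :
    HasDerivAt gap
      (-(claspSlope u * deriv claspX u) + claspSlope (1 - u) * deriv claspX (1 - u)) u := by
  have hv := Ioo.one_sub_mem hu
  have hgap := gap_pos hu
  have hX := (differentiableAt_claspX hu).hasDerivAt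
  have hX' : HasDerivAt (fun u => claspX (1 - u)) (-deriv claspX (1 - u)) u :=
    (differentiableAt_claspX hv).hasDerivAt.comp_const_sub 1 u
  have hsqrt := gap_eq_sqrt (Ioo_subset_Icc_self hu)
  have hderiv := (((hX.fun_pow 2).const_sub 1).fun_sub (hX'.fun_pow 2)).sqrt
    (Real.sqrt_pos.1 (hsqrt ▸ hgap)).ne'
  have heq : gap =ᶠ[𝓝 u] fun w => Real.sqrt (1 - claspX w ^ 2 - claspX (1 - w) ^ 2) := by
    filter_upwards [Ioo_mem_nhds hu.1 hu.2] with w hw using gap_eq_sqrt (Ioo_subset_Icc_self hw)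
  refine (hderiv.congr_of_eventuallyEq heq).congr_deriv ?_
  rw [← hsqrt, claspX_eq_gap_mul_claspSlope hu, claspX_eq_gap_mul_claspSlope hv, gap_one_sub]
  field_simp
  ring

/-- Opposite points of a clasp, at parameters `u` and `1 - u`, are `gap u` apart vertically, as the
tips are at distance `claspH`. -/
lemma claspH_sub_eq_gap {u : ℝ} (hu : u ∈ Icc (0 : ℝ) 1) :
    claspH - claspZ u - claspZ (1 - u) = gap u := by
  set f : ℝ → ℝ := fun u => claspZ u + claspZ (1 - u) + gap u
  have hcont : ContinuousOn f (Icc 0 1) :=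
    (continuousOn_claspZ.add (continuousOn_claspZ.comp (by fun_prop)
      fun u hu => Icc.one_sub_mem hu)).add continuousOn_gap
  have hderiv : ∀ w ∈ Ioo (0 : ℝ) 1, HasDerivAt f 0 w := fun w hw => by
    have hZ := (hasDerivAt_claspZ (Ioo.one_sub_mem hw)).comp_const_sub 1 w
    exact (((hasDerivAt_claspZ hw).fun_add hZ).fun_add (hasDerivAt_gap hw)).congr_deriv (by ring)
  have hconst : f u = f 0 := by
    rcases hu.1.eq_or_lt with rfl | hpos
    · rfl
    obtain ⟨w, -, hw⟩ := exists_hasDerivAt_eq_slope f (fun _ => 0) hpos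
      (hcont.mono (Icc_subset_Icc_right hu.2)) fun w hw => hderiv w ⟨hw.1, hw.2.trans_le hu.2⟩
    simpa [hpos.ne', sub_eq_zero] using hw.symm
  have hzero : f 0 = claspH := by simp [f, gap, claspH, claspZ_zero]
  simp only [f] at hconst hzero
  linarith

lemma isMinOn_Icc_of_hasDerivAt {f f' : ℝ → ℝ} {a b c : ℝ} (hb : b ∈ Icc a c)
    (hf : ContinuousOn f (Icc a c)) (hd : ∀ x ∈ Ioo a c, HasDerivAt f (f' x) x)
    (hneg : ∀ x ∈ Ioo a b, f' x ≤ 0) (hpos : ∀ x ∈ Ioo b c, 0 ≤ f' x) :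
    IsMinOn f (Icc a c) b := by
  have hleft : ∀ x ∈ Ioo a b, HasDerivAt f (f' x) x := fun x hx =>
    hd x (Ioo_subset_Ioo_right hb.2 hx)
  have hright : ∀ x ∈ Ioo b c, HasDerivAt f (f' x) x := fun x hx =>
    hd x (Ioo_subset_Ioo_left hb.1 hx)
  refine isMinOn_Icc_of_anti_mono ?_ ?_
  · refine antitoneOn_of_hasDerivWithinAt_nonpos (f' := f') (convex_Icc a b)
      (hf.mono (Icc_subset_Icc_right hb.2)) ?_ ?_ <;> rw [interior_Icc]
    exacts [fun x hx => (hleft x hx).hasDerivWithinAt, hneg]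
  · refine monotoneOn_of_hasDerivWithinAt_nonneg (f' := f') (convex_Icc b c)
      (hf.mono (Icc_subset_Icc_left hb.1)) ?_ ?_ <;> rw [interior_Icc]
    exacts [fun x hx => (hright x hx).hasDerivWithinAt, hpos]

lemma hasDerivAt_clasp_dist_sq {w : ℝ} (hw : w ∈ Ioo (0 : ℝ) 1) (v : ℝ) :
    HasDerivAt (fun u => claspX u ^ 2 + claspX v ^ 2 + (claspH - claspZ u - claspZ v) ^ 2)
      (2 * deriv claspX w * claspSlope w * (claspZ v - claspZ (1 - w))) w := by
  have hX : claspX w = (claspH - claspZ w - claspZ (1 - w)) * claspSlope w := by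
    rw [claspX_eq_gap_mul_claspSlope hw, claspH_sub_eq_gap (Ioo_subset_Icc_self hw)]
  have h := (((differentiableAt_claspX hw).hasDerivAt.fun_pow 2).add_const (claspX v ^ 2)).fun_add
    ((((hasDerivAt_claspZ hw).const_sub claspH).sub_const (claspZ v)).fun_pow 2)
  refine h.congr_deriv ?_
  rw [hX]
  push_cast
  ring

lemma one_le_clasp_dist_sq {u v : ℝ} (hu : u ∈ Icc (0 : ℝ) 1) (hv : v ∈ Icc (0 : ℝ) 1) :
    1 ≤ claspX u ^ 2 + claspX v ^ 2 + (claspH - claspZ u - claspZ v) ^ 2 := by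
  have hv' := Icc.one_sub_mem hv
  have hcont : ContinuousOn
      (fun u => claspX u ^ 2 + claspX v ^ 2 + (claspH - claspZ u - claspZ v) ^ 2) (Icc 0 1) := by
    have := continuousOn_claspX
    have := continuousOn_claspZ
    fun_prop
  have hmono := strictMonoOn_claspZ.monotoneOn
  have hmin : claspX (1 - v) ^ 2 + claspX v ^ 2 + (claspH - claspZ (1 - v) - claspZ v) ^ 2 = 1 := by
    rw [sub_right_comm, claspH_sub_eq_gap hv]
    linarith [strut_sq hv]
  refine hmin.symm.le.trans (isMinOn_Icc_of_hasDerivAt hv' hcont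
    (fun w hw => hasDerivAt_clasp_dist_sq hw v) (fun w hw => ?_) (fun w hw => ?_) hu)
  · have hw' : w ∈ Ioo (0 : ℝ) 1 := ⟨hw.1, hw.2.trans_le hv'.2⟩
    have hX := deriv_claspX_pos hw'
    have hslope := claspSlope_pos hw'
    have hZ := hmono hv (Icc.one_sub_mem (Ioo_subset_Icc_self hw')) (by linarith [hw.2])
    exact mul_nonpos_of_nonneg_of_nonpos (by positivity) (sub_nonpos.2 hZ)
  · have hw' : w ∈ Ioo (0 : ℝ) 1 := ⟨hv'.1.trans_lt hw.1, hw.2⟩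
    have hX := deriv_claspX_pos hw'
    have hslope := claspSlope_pos hw'
    have hZ := hmono (Icc.one_sub_mem (Ioo_subset_Icc_self hw')) hv (by linarith [hw.1])
    exact mul_nonneg (by positivity) (sub_nonneg.2 hZ)

lemma one_le_claspH : 1 ≤ claspH := by
  have h := one_le_clasp_dist_sq (u := 0) (v := 0) (by simp) (by simp)
  have h0 : 0 ≤ claspH := claspZ_nonneg (by simp)
  simp only [claspX_zero, claspZ_zero] at h
  nlinarith

lemma inv_gap_eq {u : ℝ} (hu : u ∈ Ioo (0 : ℝ) 1) :
    1 / gap u = claspX u * claspSlope u + claspX (1 - u) * claspSlope (1 - u) + gap u := by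
  have hX := claspX_eq_gap_mul_claspSlope hu
  have hX' := claspX_eq_gap_mul_claspSlope (Ioo.one_sub_mem hu)
  rw [gap_one_sub] at hX'
  rw [div_eq_iff (gap_pos hu).ne']
  linear_combination -strut_sq (Ioo_subset_Icc_self hu) + claspX u * hX + claspX (1 - u) * hX'

lemma intervalIntegrable_inv_gap : IntervalIntegrable (fun u => 1 / gap u) volume 0 1 := by
  have hslope : IntervalIntegrable (fun u => claspSlope (1 - u)) volume 0 1 := by
    simpa using (intervalIntegrable_claspSlope.comp_sub_left 1).symm
  have hX : ContinuousOn (fun u => claspX (1 - u)) (Icc 0 1) :=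
    continuousOn_claspX.comp (by fun_prop) fun u hu => Icc.one_sub_mem hu
  rw [← uIcc_of_le zero_le_one] at hX
  refine IntervalIntegrable.congr_uIoo (f := fun u =>
    claspX u * claspSlope u + claspX (1 - u) * claspSlope (1 - u) + gap u) ?_ fun u hu => ?_
  · refine ((intervalIntegrable_claspSlope.continuousOn_mul ?_).add
      (hslope.continuousOn_mul hX)).add (ContinuousOn.intervalIntegrable ?_)
    all_goals rw [uIcc_of_le zero_le_one]
    exacts [continuousOn_claspX, continuousOn_gap]
  · rw [uIoo_of_le zero_le_one] at hu
    exact (inv_gap_eq hu).symm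

/-! ### Half of `β` -/

lemma claspH_pos : 0 < claspH := one_pos.trans_le one_le_claspH

lemma ceil_pos {d : ℝ} (hd : 0 < d) : 0 < ceil d := by
  have := claspH_pos
  unfold ceil
  positivity

lemma halfX_of_mem_zero_one {s : ℝ} (hs : s ∈ Icc (0 : ℝ) 1) : halfX s = 1 := if_pos hs.2

lemma halfX_of_mem_one_two {s : ℝ} (hs : s ∈ Icc (1 : ℝ) 2) : halfX s = claspX (2 - s) := by
  rcases hs.1.eq_or_lt with rfl | h
  · rw [halfX, if_pos le_rfl, show (2 : ℝ) - 1 = 1 by norm_num, claspX_one]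
  · rw [halfX, if_neg h.not_ge, if_pos hs.2]

lemma halfX_of_mem_two_three {s : ℝ} (hs : s ∈ Icc (2 : ℝ) 3) : halfX s = -claspX (s - 2) := by
  rcases hs.1.eq_or_lt with rfl | h
  · rw [halfX_of_mem_one_two (by norm_num), sub_self, claspX_zero, neg_zero]
  · rw [halfX, if_neg (by linarith), if_neg h.not_ge, if_pos hs.2]

lemma halfX_of_mem_three_four {s : ℝ} (hs : s ∈ Icc (3 : ℝ) 4) : halfX s = -claspX (4 - s) := by
  rcases hs.1.eq_or_lt with rfl | h
  · rw [halfX_of_mem_two_three (by norm_num)]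
    norm_num
  · rw [halfX, if_neg (by linarith), if_neg (by linarith), if_neg h.not_ge]

lemma halfZ_of_mem_zero_one (d : ℝ) {s : ℝ} (hs : s ∈ Icc (0 : ℝ) 1) :
    halfZ d s = -ceil d + s * d := if_pos hs.2

lemma halfZ_of_mem_one_two (d : ℝ) {s : ℝ} (hs : s ∈ Icc (1 : ℝ) 2) :
    halfZ d s = -claspH / 2 - claspZ (2 - s) := by
  rcases hs.1.eq_or_lt with rfl | h
  · rw [halfZ, if_pos le_rfl, show (2 : ℝ) - 1 = 1 by norm_num, ceil, claspH]
    ring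
  · rw [halfZ, if_neg h.not_ge, if_pos hs.2]

lemma halfZ_of_mem_two_three (d : ℝ) {s : ℝ} (hs : s ∈ Icc (2 : ℝ) 3) :
    halfZ d s = -claspH / 2 + claspZ (s - 2) := by
  rcases hs.1.eq_or_lt with rfl | h
  · rw [halfZ_of_mem_one_two d (by norm_num), sub_self, claspZ_zero]
    ring
  · rw [halfZ, if_neg (by linarith), if_neg h.not_ge, if_pos hs.2]

lemma halfZ_of_mem_three_four (d : ℝ) {s : ℝ} (hs : s ∈ Icc (3 : ℝ) 4) :
    halfZ d s = 3 * claspH / 2 - claspZ (4 - s) := by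
  rcases hs.1.eq_or_lt with rfl | h
  · rw [halfZ_of_mem_two_three d (by norm_num), show (3 : ℝ) - 2 = 1 by norm_num,
      show (4 : ℝ) - 3 = 1 by norm_num, claspH]
    ring
  · rw [halfZ, if_neg (by linarith), if_neg (by linarith), if_neg h.not_ge]

lemma halfX_two : halfX 2 = 0 := by
  rw [halfX_of_mem_one_two (by norm_num), sub_self, claspX_zero]

lemma halfX_four : halfX 4 = 0 := by
  rw [halfX_of_mem_three_four (by norm_num), sub_self, claspX_zero, neg_zero]

lemma halfZ_two (d : ℝ) : halfZ d 2 = -claspH / 2 := by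
  rw [halfZ_of_mem_one_two d (by norm_num), sub_self, claspZ_zero, sub_zero]

lemma halfZ_three (d : ℝ) : halfZ d 3 = claspH / 2 := by
  rw [halfZ_of_mem_three_four d (by norm_num), show (4 : ℝ) - 3 = 1 by norm_num, claspH]
  ring

lemma halfZ_four (d : ℝ) : halfZ d 4 = 3 * claspH / 2 := by
  rw [halfZ_of_mem_three_four d (by norm_num), sub_self, claspZ_zero, sub_zero]

lemma halfZ_zero (d : ℝ) : halfZ d 0 = -ceil d := by
  rw [halfZ_of_mem_zero_one d (by norm_num), zero_mul, add_zero]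

lemma halfX_pos {s : ℝ} (hs : s ∈ Ico (0 : ℝ) 2) : 0 < halfX s := by
  rcases le_total s 1 with h | h
  · rw [halfX_of_mem_zero_one ⟨hs.1, h⟩]
    exact one_pos
  · rw [halfX_of_mem_one_two ⟨h, hs.2.le⟩]
    exact claspX_pos ⟨by linarith [hs.2], by linarith⟩

lemma halfX_neg {s : ℝ} (hs : s ∈ Ioo (2 : ℝ) 4) : halfX s < 0 := by
  rcases le_total s 3 with h | h
  · rw [halfX_of_mem_two_three ⟨hs.1.le, h⟩]
    exact neg_neg_of_pos (claspX_pos ⟨by linarith [hs.1], by linarith⟩)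
  · rw [halfX_of_mem_three_four ⟨h, hs.2.le⟩]
    exact neg_neg_of_pos (claspX_pos ⟨by linarith [hs.2], by linarith⟩)

lemma continuousOn_halfX : ContinuousOn halfX (Icc 0 4) := by
  refine continuousOn_Icc_append (b := 3) (by norm_num) (by norm_num)
    (continuousOn_Icc_append (b := 2) (by norm_num) (by norm_num)
      (continuousOn_Icc_append (b := 1) (by norm_num) (by norm_num) ?_ ?_) ?_) ?_
  · exact continuousOn_const.congr fun s hs => halfX_of_mem_zero_one hs
  · exact (continuousOn_claspX.comp (by fun_prop : ContinuousOn (fun s : ℝ => 2 - s) _)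
      fun s hs => ⟨by linarith [hs.2], by linarith [hs.1]⟩).congr
      fun s hs => halfX_of_mem_one_two hs
  · exact (continuousOn_claspX.comp (by fun_prop : ContinuousOn (fun s : ℝ => s - 2) _)
      fun s hs => ⟨by linarith [hs.1], by linarith [hs.2]⟩).neg.congr
      fun s hs => halfX_of_mem_two_three hs
  · exact (continuousOn_claspX.comp (by fun_prop : ContinuousOn (fun s : ℝ => 4 - s) _)
      fun s hs => ⟨by linarith [hs.2], by linarith [hs.1]⟩).neg.congr
      fun s hs => halfX_of_mem_three_four hs

lemma continuousOn_halfZ (d : ℝ) : ContinuousOn (halfZ d) (Icc 0 4) := by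
  refine continuousOn_Icc_append (b := 3) (by norm_num) (by norm_num)
    (continuousOn_Icc_append (b := 2) (by norm_num) (by norm_num)
      (continuousOn_Icc_append (b := 1) (by norm_num) (by norm_num) ?_ ?_) ?_) ?_
  · exact (by fun_prop : ContinuousOn (fun s => -ceil d + s * d) _).congr
      fun s hs => halfZ_of_mem_zero_one d hs
  · exact (continuousOn_const.sub (continuousOn_claspZ.comp
      (by fun_prop : ContinuousOn (fun s : ℝ => 2 - s) _)
      fun s hs => ⟨by linarith [hs.2], by linarith [hs.1]⟩)).congr
      fun s hs => halfZ_of_mem_one_two d hs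
  · exact (continuousOn_const.add (continuousOn_claspZ.comp
      (by fun_prop : ContinuousOn (fun s : ℝ => s - 2) _)
      fun s hs => ⟨by linarith [hs.1], by linarith [hs.2]⟩)).congr
      fun s hs => halfZ_of_mem_two_three d hs
  · exact (continuousOn_const.sub (continuousOn_claspZ.comp
      (by fun_prop : ContinuousOn (fun s : ℝ => 4 - s) _)
      fun s hs => ⟨by linarith [hs.2], by linarith [hs.1]⟩)).congr
      fun s hs => halfZ_of_mem_three_four d hs

lemma strictMonoOn_halfZ {d : ℝ} (hd : 0 < d) : StrictMonoOn (halfZ d) (Icc 0 4) := by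
  refine strictMonoOn_Icc_append (b := 3) (by norm_num) (by norm_num)
    (strictMonoOn_Icc_append (b := 2) (by norm_num) (by norm_num)
      (strictMonoOn_Icc_append (b := 1) (by norm_num) (by norm_num) ?_ ?_) ?_) ?_
  · intro s hs t ht hst
    rw [halfZ_of_mem_zero_one d hs, halfZ_of_mem_zero_one d ht]
    nlinarith
  · intro s hs t ht hst
    rw [halfZ_of_mem_one_two d hs, halfZ_of_mem_one_two d ht]
    have := strictMonoOn_claspZ (a := 2 - t) (b := 2 - s) ⟨by linarith [ht.2], by linarith [ht.1]⟩
      ⟨by linarith [hs.2], by linarith [hs.1]⟩ (by linarith)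
    linarith
  · intro s hs t ht hst
    rw [halfZ_of_mem_two_three d hs, halfZ_of_mem_two_three d ht]
    have := strictMonoOn_claspZ (a := s - 2) (b := t - 2) ⟨by linarith [hs.1], by linarith [hs.2]⟩
      ⟨by linarith [ht.1], by linarith [ht.2]⟩ (by linarith)
    linarith
  · intro s hs t ht hst
    rw [halfZ_of_mem_three_four d hs, halfZ_of_mem_three_four d ht]
    have := strictMonoOn_claspZ (a := 4 - t) (b := 4 - s) ⟨by linarith [ht.2], by linarith [ht.1]⟩
      ⟨by linarith [hs.2], by linarith [hs.1]⟩ (by linarith)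
    linarith

lemma halfZ_mem {d : ℝ} (hd : 0 < d) {s : ℝ} (hs : s ∈ Icc (0 : ℝ) 4) :
    halfZ d s ∈ Icc (-ceil d) (3 * claspH / 2) := by
  have hmono := (strictMonoOn_halfZ hd).monotoneOn
  rw [← halfZ_zero, ← halfZ_four d]
  exact ⟨hmono (by simp) hs hs.1, hmono hs (by simp) hs.2⟩

lemma half_cases {d s : ℝ} (hs : s ∈ Icc (0 : ℝ) 4) :
    halfX s ^ 2 = 1 ∨ ∃ u ∈ Icc (0 : ℝ) 1, halfX s ^ 2 = claspX u ^ 2 ∧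
      (halfZ d s = -claspH / 2 - claspZ u ∨ halfZ d s = -claspH / 2 + claspZ u ∨
        halfZ d s = 3 * claspH / 2 - claspZ u) := by
  rcases le_total s 1 with h1 | h1
  · left
    rw [halfX_of_mem_zero_one ⟨hs.1, h1⟩, one_pow]
  right
  rcases le_total s 2 with h2 | h2
  · exact ⟨2 - s, ⟨by linarith, by linarith⟩, by rw [halfX_of_mem_one_two ⟨h1, h2⟩],
      .inl (halfZ_of_mem_one_two d ⟨h1, h2⟩)⟩
  rcases le_total s 3 with h3 | h3
  · exact ⟨s - 2, ⟨by linarith, by linarith⟩, by rw [halfX_of_mem_two_three ⟨h2, h3⟩, neg_sq],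
      .inr (.inl (halfZ_of_mem_two_three d ⟨h2, h3⟩))⟩
  · exact ⟨4 - s, ⟨by linarith [hs.2], by linarith⟩,
      by rw [halfX_of_mem_three_four ⟨h3, hs.2⟩, neg_sq],
      .inr (.inr (halfZ_of_mem_three_four d ⟨h3, hs.2⟩))⟩

lemma one_le_half_dist_sq (d : ℝ) {s t : ℝ} (hs : s ∈ Icc (0 : ℝ) 4) (ht : t ∈ Icc (0 : ℝ) 4) :
    1 ≤ halfX s ^ 2 + halfX t ^ 2 + (halfZ d s + halfZ d t) ^ 2 := by
  rcases half_cases (d := d) hs with h | ⟨u, hu, hx, hz⟩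
  · nlinarith [sq_nonneg (halfX t), sq_nonneg (halfZ d s + halfZ d t)]
  rcases half_cases (d := d) ht with h | ⟨v, hv, hy, hw⟩
  · nlinarith [sq_nonneg (halfX s), sq_nonneg (halfZ d s + halfZ d t)]
  -- among the nine pairs of arcs, the ones facing each other in a clasp are the closest
  have habs : |claspH - claspZ u - claspZ v| ≤ |halfZ d s + halfZ d t| := by
    have hH := claspH_pos
    have hu0 := claspZ_nonneg hu
    have hv0 := claspZ_nonneg hv
    have hu1 := claspZ_le_claspH hu
    have hv1 := claspZ_le_claspH hv
    rcases abs_cases (claspH - claspZ u - claspZ v) with ⟨e, -⟩ | ⟨e, -⟩ <;>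
      rcases hz with hz | hz | hz <;> rcases hw with hw | hw | hw <;> rw [e, hz, hw, le_abs] <;>
      first | (left; linarith) | (right; linarith)
  rw [hx, hy]
  exact (one_le_clasp_dist_sq hu hv).trans (add_le_add_right (sq_le_sq.2 habs) _)

/-! ### The components -/

/-- Scaling of the horizontal coordinates; for `e = -1` this is the half-turn about the
`z`-axis. -/
def horizontalScale (e : ℝ) (q : E3) : E3 := !₂[e * q 0, e * q 1, q 2]

/-- A strand on `[0, 1/2]`, followed by its image under the half-turn about the `z`-axis, traversed
backwards. -/
def double (f : ℝ → E3) (s : ℝ) : E3 := if s ≤ 1 / 2 then f s else horizontalScale (-1) (f (1 - s))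

/-- The parameter in `[0, 1/2]` of the point of the strand `f` from which `double f s` is
obtained. -/
def fold (s : I) : ℝ := min (s : ℝ) (1 - s)

lemma fold_mem (s : I) : fold s ∈ Icc (0 : ℝ) (1 / 2) :=
  ⟨le_min s.2.1 (by linarith [s.2.2]), min_le_iff.2 (by by_contra! h; linarith [h.1, h.2])⟩

lemma fold_zero : fold 0 = 0 := by simp [fold]

lemma fold_one : fold 1 = 0 := by simp [fold]

lemma continuous_fold : Continuous fold := by
  unfold fold
  fun_prop

lemma eight_mul_mem {s : ℝ} (hs : s ∈ Icc (0 : ℝ) (1 / 2)) : 8 * s ∈ Icc (0 : ℝ) 4 :=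
  ⟨by linarith [hs.1], by linarith [hs.2]⟩

lemma horizontalScale_one (q : E3) : horizontalScale 1 q = q :=
  vec_ext (one_mul _) (one_mul _) rfl

lemma horizontalScale_mul (e e' : ℝ) (q : E3) :
    horizontalScale (e * e') q = horizontalScale e (horizontalScale e' q) :=
  vec_ext (mul_assoc _ _ _) (mul_assoc _ _ _) rfl

lemma continuous_horizontalScale (e : ℝ) : Continuous (horizontalScale e) :=
  continuous_vec (by fun_prop) (by fun_prop) (by fun_prop)

lemma double_eq_ite_fold (f : ℝ → E3) (s : I) :
    double f s = if (s : ℝ) ≤ 1 / 2 then f (fold s) else horizontalScale (-1) (f (fold s)) := by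
  unfold double fold
  split_ifs with h
  · rw [min_eq_left (by linarith)]
  · rw [min_eq_right (by linarith)]

lemma exists_double_eq (f : ℝ → E3) (s : I) :
    ∃ e : ℝ, e ^ 2 = 1 ∧ double f s = horizontalScale e (f (fold s)) := by
  rw [double_eq_ite_fold]
  split_ifs
  · exact ⟨1, one_pow 2, (horizontalScale_one _).symm⟩
  · exact ⟨-1, neg_one_sq, rfl⟩

lemma double_apply_two (f : ℝ → E3) (s : I) : double f s 2 = f (fold s) 2 := by
  obtain ⟨e, -, h⟩ := exists_double_eq f s
  rw [h]
  rfl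

lemma double_ne_double {f g : ℝ → E3}
    (h : ∀ s ∈ Icc (0 : ℝ) (1 / 2), ∀ t ∈ Icc (0 : ℝ) (1 / 2), ∀ e : ℝ, e ^ 2 = 1 →
      f s ≠ horizontalScale e (g t)) (s t : I) :
    double f s ≠ double g t := by
  obtain ⟨e, he, hs⟩ := exists_double_eq f s
  obtain ⟨e', he', ht⟩ := exists_double_eq g t
  intro heq
  refine h _ (fold_mem s) _ (fold_mem t) (e * e') (by rw [mul_pow, he, he', one_mul]) ?_
  rw [horizontalScale_mul, ← ht, ← heq, hs, ← horizontalScale_mul, ← sq, he, horizontalScale_one]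

lemma continuous_double {X : Type*} [TopologicalSpace X] {f : X → ℝ → E3} {s : X → I}
    (hs : Continuous s) (hf : Continuous fun x => f x (fold (s x)))
    (h0 : ∀ x, f x (1 / 2) 0 = 0) (h1 : ∀ x, f x (1 / 2) 1 = 0) :
    Continuous fun x => double (f x) (s x) := by
  simp only [double_eq_ite_fold]
  refine hf.if_le ((continuous_horizontalScale _).comp hf) (by fun_prop) continuous_const
    fun x hx => ?_
  have hfold : fold (s x) = 1 / 2 := by
    rw [fold, hx]
    norm_num
  rw [hfold]
  refine vec_ext ?_ ?_ rfl <;> simp only [horizontalScale, Matrix.cons_val, h0, h1, mul_zero]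

/-- The half of `β` on the parameter interval `[0, 1/2]`. -/
def halfCurve (d s : ℝ) : E3 := !₂[halfX (8 * s), 0, halfZ d (8 * s)]

lemma beta_eq_double (d : ℝ) (s : I) : beta d s = double (halfCurve d) s := by
  simp [beta, double, halfCurve, horizontalScale]

lemma beta_apply_zero_sq (d : ℝ) (s : I) : beta d s 0 ^ 2 = halfX (8 * fold s) ^ 2 := by
  obtain ⟨e, he, h⟩ := exists_double_eq (halfCurve d) s
  simp [beta_eq_double, h, horizontalScale, halfCurve, mul_pow, he]

lemma beta_apply_one (d : ℝ) (s : I) : beta d s 1 = 0 := by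
  obtain ⟨e, -, h⟩ := exists_double_eq (halfCurve d) s
  simp [beta_eq_double, h, horizontalScale, halfCurve]

lemma beta_apply_two (d : ℝ) (s : I) : beta d s 2 = halfZ d (8 * fold s) := by
  rw [beta_eq_double, double_apply_two]
  simp [halfCurve]

lemma continuous_halfX_fold : Continuous fun s => halfX (8 * fold s) :=
  continuousOn_halfX.comp_continuous (continuous_const.mul continuous_fold)
    fun s => eight_mul_mem (fold_mem s)

lemma continuous_halfZ_fold (d : ℝ) : Continuous fun s => halfZ d (8 * fold s) :=
  (continuousOn_halfZ d).comp_continuous (continuous_const.mul continuous_fold)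
    fun s => eight_mul_mem (fold_mem s)

lemma continuous_beta (d : ℝ) : Continuous (beta d) := by
  rw [funext (beta_eq_double d)]
  refine continuous_double (f := fun _ => halfCurve d) continuous_id
    (continuous_vec continuous_halfX_fold continuous_const (continuous_halfZ_fold d))
    (fun _ => ?_) fun _ => rfl
  change halfX (8 * (1 / 2)) = 0
  rw [show (8 : ℝ) * (1 / 2) = 4 by norm_num, halfX_four]

/-- The rotation `(x₁, x₂, z) ↦ (x₂, x₁, -z)`, which interchanges the two components. -/
def interchange : E3 →ₗᵢ[ℝ] E3 where
  toFun q := !₂[q 1, q 0, -q 2]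
  map_add' p q := vec_ext (by simp) (by simp) (by simp [add_comm])
  map_smul' c q := vec_ext (by simp) (by simp) (by simp)
  norm_map' q := by
    rw [← sq_eq_sq₀ (norm_nonneg _) (norm_nonneg _), norm_vec_sq, norm_vec_sq]
    simp [add_comm]

lemma interchange_apply (q : E3) : interchange q = !₂[q 1, q 0, -q 2] := rfl

lemma gamma_eq_interchange (d : ℝ) (s : I) : gamma d s = interchange (beta d s) := rfl

lemma continuous_gamma (d : ℝ) : Continuous (gamma d) :=
  interchange.continuous.comp (continuous_beta d)

lemma abs_beta_two_le {d : ℝ} (hd : 0 < d) (s : I) : |beta d s 2| ≤ ceil d := by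
  obtain ⟨hlow, hupp⟩ := halfZ_mem hd (eight_mul_mem (fold_mem s))
  rw [beta_apply_two, abs_le]
  refine ⟨hlow, hupp.trans ?_⟩
  unfold ceil
  linarith

lemma one_le_dist_beta_gamma (d : ℝ) (s t : I) : 1 ≤ dist (beta d s) (gamma d t) := by
  rw [dist_eq_norm, ← one_le_sq_iff₀ (norm_nonneg _), norm_vec_sq]
  simpa [gamma, beta_apply_one, beta_apply_zero_sq, beta_apply_two] using
    one_le_half_dist_sq d (eight_mul_mem (fold_mem s)) (eight_mul_mem (fold_mem t))

lemma eq_two_or_eq_four_of_halfX_eq_zero {s : ℝ} (hs : s ∈ Icc (0 : ℝ) 4) (h : halfX s = 0) :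
    s = 2 ∨ s = 4 := by
  by_contra! hne
  rcases lt_or_gt_of_ne hne.1 with hlt | hgt
  · exact (halfX_pos ⟨hs.1, hlt⟩).ne' h
  · exact (halfX_neg ⟨hgt, lt_of_le_of_ne hs.2 hne.2⟩).ne h

lemma eq_or_add_eq_one_of_fold_eq {s t : I} (h : fold s = fold t) :
    s = t ∨ (s : ℝ) + t = 1 := by
  rw [Subtype.ext_iff]
  unfold fold at h
  rcases min_cases (s : ℝ) (1 - s) with ⟨e, -⟩ | ⟨e, -⟩ <;>
    rcases min_cases (t : ℝ) (1 - t) with ⟨e', -⟩ | ⟨e', -⟩ <;> rw [e, e'] at h <;>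
    first | (left; linarith) | (right; linarith)

/-- The height determines the parameter up to the reflection `s ↦ 1 - s`, and the points with
parameters `s` and `1 - s` agree only on the axis. -/
lemma beta_eq_of_ne {d : ℝ} (hd : 0 < d) {s t : I} (hst : s ≠ t) (h : beta d s = beta d t) :
    beta d s = !₂[0, 0, -claspH / 2] := by
  wlog hle : (s : ℝ) ≤ t generalizing s t
  · rw [h]
    exact this hst.symm h.symm (le_of_not_ge hle)
  have hfold : fold s = fold t := by
    have := (strictMonoOn_halfZ hd).injOn (eight_mul_mem (fold_mem s)) (eight_mul_mem (fold_mem t))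
      (by rw [← beta_apply_two, ← beta_apply_two, h])
    linarith
  have hsum : (s : ℝ) + t = 1 := (eq_or_add_eq_one_of_fold_eq hfold).resolve_left hst
  have hs : (s : ℝ) ≤ 1 / 2 := by linarith
  have hβs : beta d s = halfCurve d s := by rw [beta_eq_double, double, if_pos hs]
  have hβt : beta d t = horizontalScale (-1) (halfCurve d s) := by
    have ht : ¬(t : ℝ) ≤ 1 / 2 := fun ht => hst (Subtype.ext (by linarith))
    rw [beta_eq_double, double, if_neg ht, ← hsum, add_sub_cancel_right]
  have hx : halfX (8 * s) = 0 := by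
    have h0 : halfX (8 * s) = -halfX (8 * s) := by
      simpa [hβs, hβt, halfCurve, horizontalScale] using congrArg (fun q : E3 => q 0) h
    linarith
  rcases eq_two_or_eq_four_of_halfX_eq_zero (eight_mul_mem ⟨s.2.1, hs⟩) hx with h2 | h4
  · rw [hβs, halfCurve, h2, halfX_two, halfZ_two]
  · exact absurd (Subtype.ext (by linarith)) hst

lemma existsUnique_self_intersection {d : ℝ} (hd : 0 < d) (i : Fin 2) :
    ∃! q : E3, ∃ s t : I, s ≠ t ∧
      (grannyClasp d).arc i s = q ∧ (grannyClasp d).arc i t = q := by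
  obtain ⟨s, t, hst, h⟩ : ∃ s t : I, s ≠ t ∧ beta d s = beta d t := by
    refine ⟨⟨1 / 4, by norm_num, by norm_num⟩, ⟨3 / 4, by norm_num, by norm_num⟩, fun h => ?_, ?_⟩
    · norm_num [Subtype.ext_iff] at h
    · norm_num [beta, halfX_two, halfZ_two]
  have hs := beta_eq_of_ne hd hst h
  have ht := beta_eq_of_ne hd hst.symm h.symm
  fin_cases i
  · refine ⟨!₂[0, 0, -claspH / 2], ⟨s, t, hst, hs, ht⟩, ?_⟩
    rintro q ⟨s', t', hst', rfl, h'⟩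
    exact beta_eq_of_ne hd hst' h'.symm
  · refine ⟨interchange !₂[0, 0, -claspH / 2],
      ⟨s, t, hst, congrArg interchange hs, congrArg interchange ht⟩, ?_⟩
    rintro q ⟨s', t', hst', rfl, h'⟩
    exact congrArg interchange (beta_eq_of_ne hd hst' (interchange.injective h'.symm))

/-! ### Constraints -/

lemma mem_horizontalPlane {c : ℝ} {q : E3} : q ∈ horizontalPlane c ↔ q 2 = c := by
  rw [horizontalPlane, AffineSubspace.mem_mk']
  simp [sub_eq_zero]

lemma mem_horizontalPlane_direction {c : ℝ} {q : E3} :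
    q ∈ (horizontalPlane c).direction ↔ q 2 = 0 := by
  rw [horizontalPlane, AffineSubspace.direction_mk']
  simp

lemma grannyClasp_admits_iff {d : ℝ} {δ : Fin 2 → I → E3} :
    (grannyClasp d).Admits δ ↔ (∀ s t, δ 0 s ≠ δ 1 t) ∧
      (δ 0 0 2 = -ceil d ∧ δ 0 1 2 = -ceil d) ∧ (δ 1 0 2 = ceil d ∧ δ 1 1 2 = ceil d) ∧
      ∀ i s, |δ i s 2| ≤ ceil d := by
  simp only [GenLink.Admits, grannyClasp, Fin.forall_fin_two, Matrix.cons_val_zero,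
    Matrix.cons_val_one, mem_horizontalPlane, abs_le]
  constructor
  · rintro ⟨⟨⟨-, h⟩, -⟩, ⟨ha, hb⟩, ⟨h0, h1⟩, h2, h3⟩
    exact ⟨h (by simp), ha, hb, fun s => ⟨by linarith [h0 s], by linarith [h2 s]⟩,
      fun s => ⟨by linarith [h1 s], by linarith [h3 s]⟩⟩
  · rintro ⟨h, ha, hb, h0, h1⟩
    exact ⟨⟨⟨fun h => absurd rfl h, fun _ => h⟩, fun _ s t e => h t s e.symm,
      fun h => absurd rfl h⟩,
      ⟨ha, hb⟩, ⟨fun s => by linarith [(h0 s).1], fun s => by linarith [(h1 s).1]⟩,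
      fun s => by linarith [(h0 s).2], fun s => by linarith [(h1 s).2]⟩

lemma grannyClasp_admits {d : ℝ} (hd : 0 < d) : (grannyClasp d).Admits (grannyClasp d).arc := by
  have h0 : beta d 0 2 = -ceil d := by rw [beta_apply_two, fold_zero, mul_zero, halfZ_zero]
  have h1 : beta d 1 2 = -ceil d := by rw [beta_apply_two, fold_one, mul_zero, halfZ_zero]
  refine grannyClasp_admits_iff.2 ⟨fun s t h => ?_, ⟨h0, h1⟩, ⟨?_, ?_⟩, ?_⟩
  · exact (zero_lt_one.trans_le (one_le_dist_beta_gamma d s t)).ne' (dist_eq_zero.2 h)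
  · exact neg_eq_iff_eq_neg.2 h0
  · exact neg_eq_iff_eq_neg.2 h1
  · refine Fin.forall_fin_two.2 ⟨abs_beta_two_le hd, fun s => ?_⟩
    exact (abs_neg (beta d s 2)).trans_le (abs_beta_two_le hd s)

/-- The height above the middle level, as a continuous linear functional. -/
def height : E3 →L[ℝ] ℝ := EuclideanSpace.proj (2 : Fin 3)

lemma height_ne_zero : height ≠ 0 := fun h => by
  simpa [height] using congrArg (fun L : E3 →L[ℝ] ℝ => L !₂[0, 0, 1]) h

lemma continuous_grannyClasp_arc (d : ℝ) (i : Fin 2) : Continuous ((grannyClasp d).arc i) := by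
  fin_cases i
  · exact continuous_beta d
  · exact continuous_gamma d

lemma grannyClasp_isGenLink {d : ℝ} (hd : 0 < d) : (grannyClasp d).IsGenLink := by
  refine ⟨continuous_grannyClasp_arc d, grannyClasp_admits hd, Fin.forall_fin_two.2 ⟨?_, ?_⟩⟩
  · refine ⟨height.contDiff.add contDiff_const, fun q _ => ?_⟩
    exact (height.hasFDerivAt.add_const (ceil d)).fderiv.trans_ne height_ne_zero
  · refine ⟨contDiff_const.sub height.contDiff, fun q _ => ?_⟩
    exact (height.hasFDerivAt.const_sub (ceil d)).fderiv.trans_ne (neg_ne_zero.2 height_ne_zero)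

/-! ### The link homotopy to the standard picture -/

/-- Half the twisting angle, at height `ζ h`. -/
def screw (ζ : ℝ) : ℝ := 3 * Real.pi / 4 * (max (-1) (min 1 (3 * ζ)) + 1)

/-- Distance by which the strands are moved apart at height `ζ h`. -/
def shift (ζ : ℝ) : ℝ := min 1 (2 - 3 * ζ)

/-- The relative height on the lower rope in the standard picture. -/
def level (s : ℝ) : ℝ := -1 + 10 / 3 * s

/-- Position in its plane of a strand during the first stage of the homotopy. In the standard
picture, two points twisted around a line by the angle `2θ` are, up to a rotation by `θ`, at the
positions `2 cos θ` and `2 sin θ` on two perpendicular lines, and then moved apart. -/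
def planarX (a s : ℝ) : ℝ := (1 - a) * halfX (8 * s) + a * (2 * Real.cos (screw (level s)))

/-- Height of a strand during the first stage of the homotopy. -/
def planarZ (d a s : ℝ) : ℝ := (1 - a) * halfZ d (8 * s) + a * (ceil d * level s)

/-- The point with polar coordinates `r, θ` around the vertical line `x₁ = w`, `x₂ = 0`, at height
`z`. -/
def helixPoint (r θ w z : ℝ) : E3 := !₂[r * Real.cos θ + w, r * Real.sin θ, z]

/-- A half of the lower component during the homotopy. The parameters `a`, `b`, `c` of its three
stages run from `0` to `1` one after the other: first the components move in their planes, so that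
they can meet only on the axis; then the slab is twisted by a screw motion; finally the two clasped
pairs of strands are moved apart. -/
def lowerStrand (d a b c s : ℝ) : E3 :=
  helixPoint (planarX a s) (b * screw (level s)) (c * shift (level s)) (planarZ d a s)

/-- A half of the upper component during the homotopy. -/
def upperStrand (d a b c s : ℝ) : E3 :=
  helixPoint (planarX a s) (Real.pi / 2 + b * screw (-level s)) (c * shift (level s))
    (-planarZ d a s)

lemma cos_three_pi_div_two_sub (x : ℝ) : Real.cos (3 * Real.pi / 2 - x) = -Real.sin x := by
  rw [show 3 * Real.pi / 2 - x = Real.pi / 2 - x + Real.pi by ring, Real.cos_add_pi,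
    Real.cos_pi_div_two_sub]

lemma screw_neg (ζ : ℝ) : screw (-ζ) = 3 * Real.pi / 2 - screw ζ := by
  have hclamp : max (-1) (min 1 (3 * -ζ)) = -max (-1) (min 1 (3 * ζ)) := by
    grind
  unfold screw
  rw [hclamp]
  ring

lemma cos_screw_neg (ζ : ℝ) : Real.cos (screw (-ζ)) = -Real.sin (screw ζ) := by
  rw [screw_neg, cos_three_pi_div_two_sub]

lemma screw_of_le {ζ : ℝ} (h : ζ ≤ -1 / 3) : screw ζ = 0 := by
  rw [screw, min_eq_right (by linarith), max_eq_left (by linarith)]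
  ring

lemma screw_of_ge {ζ : ℝ} (h : 1 / 3 ≤ ζ) : screw ζ = 3 * Real.pi / 2 := by
  rw [screw, min_eq_left (by linarith), max_eq_right (by norm_num)]
  ring

lemma screw_of_mem {ζ : ℝ} (h : ζ ∈ Icc (-1 / 3 : ℝ) (1 / 3)) : screw ζ = twist ζ / 2 := by
  rw [screw, min_eq_right (by linarith [h.2]), max_eq_right (by linarith [h.1]), twist]
  ring

lemma cos_screw_of_ge {ζ : ℝ} (h : 1 / 3 ≤ ζ) : Real.cos (screw ζ) = 0 := by
  simpa [screw_of_ge h] using cos_three_pi_div_two_sub 0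

lemma cos_screw_pos_of_lt {ζ : ℝ} (h : ζ < -1 / 9) : 0 < Real.cos (screw ζ) := by
  rcases le_total ζ (-1 / 3) with h' | h'
  · rw [screw_of_le h', Real.cos_zero]
    exact one_pos
  · rw [screw_of_mem ⟨h', by linarith⟩, twist]
    have := Real.pi_pos
    exact Real.cos_pos_of_mem_Ioo ⟨by nlinarith, by nlinarith⟩

lemma cos_screw_neg_of_mem {ζ : ℝ} (h : ζ ∈ Ioo (-1 / 9 : ℝ) (1 / 3)) :
    Real.cos (screw ζ) < 0 := by
  rw [screw_of_mem ⟨by linarith [h.1], h.2.le⟩, twist]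
  have := Real.pi_pos
  exact Real.cos_neg_of_pi_div_two_lt_of_lt (by nlinarith [h.1]) (by nlinarith [h.2])

lemma shift_mem {ζ : ℝ} (h : ζ ≤ 2 / 3) : shift ζ ∈ Icc (0 : ℝ) 1 :=
  ⟨le_min zero_le_one (by linarith), min_le_left _ _⟩

lemma level_mem {s : ℝ} (hs : s ∈ Icc (0 : ℝ) (1 / 2)) : level s ∈ Icc (-1 : ℝ) (2 / 3) := by
  unfold level
  exact ⟨by linarith [hs.1], by linarith [hs.2]⟩

lemma planarX_half (a : ℝ) : planarX a (1 / 2) = 0 := by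
  rw [planarX, level, cos_screw_of_ge (by norm_num), show (8 : ℝ) * (1 / 2) = 4 by norm_num,
    halfX_four]
  ring

lemma planarX_one (s : ℝ) : planarX 1 s = 2 * Real.cos (screw (level s)) := by
  simp [planarX]

lemma planarZ_zero (d a : ℝ) : planarZ d a 0 = -ceil d := by
  rw [planarZ, level, mul_zero, halfZ_zero]
  ring

lemma planarZ_one (d s : ℝ) : planarZ d 1 s = ceil d * level s := by
  simp [planarZ]

section Planar

variable {d a s : ℝ}

lemma convex_combination_mem {S : Set ℝ} (hS : Convex ℝ S) (ha : a ∈ Icc (0 : ℝ) 1) {x y : ℝ}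
    (hx : x ∈ S) (hy : y ∈ S) : (1 - a) * x + a * y ∈ S :=
  hS hx hy (sub_nonneg.2 ha.2) ha.1 (sub_add_cancel 1 a)

lemma convex_combination_lt (ha : a ∈ Icc (0 : ℝ) 1) {x x' y y' : ℝ} (hx : x < x') (hy : y < y') :
    (1 - a) * x + a * y < (1 - a) * x' + a * y' := by
  have h : 0 < (1 - a) * (x' - x) + a * (y' - y) :=
    convex_combination_mem (convex_Ioi 0) ha (sub_pos.2 hx) (sub_pos.2 hy)
  linarith

lemma abs_planarZ_le (hd : 0 < d) (ha : a ∈ Icc (0 : ℝ) 1) (hs : s ∈ Icc (0 : ℝ) (1 / 2)) :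
    |planarZ d a s| ≤ ceil d := by
  obtain ⟨hlow, hupp⟩ := halfZ_mem hd (eight_mul_mem hs)
  obtain ⟨hlevel, hlevel'⟩ := level_mem hs
  have hc := ceil_pos hd
  refine abs_le.2 (convex_combination_mem (convex_Icc _ _) ha ⟨hlow, hupp.trans ?_⟩ ⟨?_, ?_⟩)
  · unfold ceil
    linarith
  · nlinarith
  · nlinarith

lemma planarX_pos (ha : a ∈ Icc (0 : ℝ) 1) (hs : s ∈ Ico (0 : ℝ) (1 / 4)) : 0 < planarX a s := by
  have hlevel : level s < -1 / 9 := by unfold level; linarith [hs.2]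
  exact convex_combination_mem (convex_Ioi 0) ha
    (halfX_pos ⟨by linarith [hs.1], by linarith [hs.2]⟩)
    (mul_pos two_pos (cos_screw_pos_of_lt hlevel))

lemma planarX_neg (ha : a ∈ Icc (0 : ℝ) 1) (hs : s ∈ Ioo (4 / 15 : ℝ) (2 / 5)) :
    planarX a s < 0 := by
  have hlevel : level s ∈ Ioo (-1 / 9 : ℝ) (1 / 3) := by
    unfold level
    exact ⟨by linarith [hs.1], by linarith [hs.2]⟩
  exact convex_combination_mem (convex_Iio 0) ha
    (halfX_neg ⟨by linarith [hs.1], by linarith [hs.2]⟩)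
    (mul_neg_of_pos_of_neg two_pos (cos_screw_neg_of_mem hlevel))

lemma halfZ_neg {s : ℝ} (hs : s ∈ Ico (2 : ℝ) (5 / 2)) : halfZ d s < 0 := by
  have hu : s - 2 ∈ Icc (0 : ℝ) 1 := ⟨by linarith [hs.1], by linarith [hs.2]⟩
  have hgap := claspH_sub_eq_gap hu
  have hmono := strictMonoOn_claspZ hu (Icc.one_sub_mem hu) (by linarith [hs.2])
  rw [halfZ_of_mem_two_three d ⟨hs.1, by linarith [hs.2]⟩]
  linarith [gap_nonneg (s - 2)]

/-- Height which separates, in absolute value, the two kinds of points where a component meets the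
axis in the first stage of the homotopy. -/
def separatingHeight (d a : ℝ) : ℝ := (1 - a) * (claspH / 2) + a * (ceil d / 4)

lemma planarZ_mem_Ico (hd : 0 < d) (ha : a ∈ Icc (0 : ℝ) 1)
    (hs : s ∈ Icc (1 / 4 : ℝ) (4 / 15)) :
    planarZ d a s ∈ Ico (-separatingHeight d a) 0 := by
  have hc := ceil_pos hd
  have hlow : -(claspH / 2) ≤ halfZ d (8 * s) := by
    rw [← neg_div, ← halfZ_two d]
    exact (strictMonoOn_halfZ hd).monotoneOn (by norm_num)
      ⟨by linarith [hs.1], by linarith [hs.2]⟩ (by linarith [hs.1])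
  have hlevel : -(1 / 4) ≤ level s ∧ level s < 0 := by
    unfold level
    exact ⟨by linarith [hs.1], by linarith [hs.2]⟩
  refine ⟨?_, convex_combination_mem (convex_Iio 0) ha
    (halfZ_neg ⟨by linarith [hs.1], by linarith [hs.2]⟩) (mul_neg_of_pos_of_neg hc hlevel.2)⟩
  have h : 0 ≤ (1 - a) * (halfZ d (8 * s) + claspH / 2) + a * (ceil d * (level s + 1 / 4)) :=
    convex_combination_mem (convex_Ici 0) ha (mem_Ici.2 (by linarith))
      (mul_nonneg hc.le (by linarith [hlevel.1]))
  unfold separatingHeight planarZ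
  linarith

lemma separatingHeight_lt_planarZ (hd : 0 < d) (ha : a ∈ Icc (0 : ℝ) 1)
    (hs : s ∈ Icc (2 / 5 : ℝ) (1 / 2)) : separatingHeight d a < planarZ d a s := by
  have hc := ceil_pos hd
  refine convex_combination_lt ha ?_ ?_
  · rw [← halfZ_three d]
    exact strictMonoOn_halfZ hd (by norm_num) ⟨by linarith [hs.1], by linarith [hs.2]⟩
      (by linarith [hs.1])
  · have : 1 / 4 < level s := by unfold level; linarith [hs.1]
    nlinarith

lemma planarZ_of_planarX_eq_zero (hd : 0 < d) (ha : a ∈ Icc (0 : ℝ) 1)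
    (hs : s ∈ Icc (0 : ℝ) (1 / 2)) (h : planarX a s = 0) :
    planarZ d a s ∈ Ico (-separatingHeight d a) 0 ∨ separatingHeight d a < planarZ d a s := by
  rcases lt_or_ge s (1 / 4) with h1 | h1
  · exact absurd h (planarX_pos ha ⟨hs.1, h1⟩).ne'
  rcases le_or_gt s (4 / 15) with h2 | h2
  · exact .inl (planarZ_mem_Ico hd ha ⟨h1, h2⟩)
  rcases lt_or_ge s (2 / 5) with h3 | h3
  · exact absurd h (planarX_neg ha ⟨h2, h3⟩).ne
  · exact .inr (separatingHeight_lt_planarZ hd ha ⟨h3, hs.2⟩)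

end Planar

lemma horizontalScale_helixPoint (e r θ w z : ℝ) :
    horizontalScale e (helixPoint r θ w z) = helixPoint (e * r) θ (e * w) z :=
  vec_ext (by simp [horizontalScale, helixPoint]; ring)
    (by simp [horizontalScale, helixPoint, mul_assoc]) rfl

lemma helixPoint_inj {r θ w z r' θ' w' z' : ℝ} :
    helixPoint r θ w z = helixPoint r' θ' w' z' ↔
      r * Real.cos θ + w = r' * Real.cos θ' + w' ∧ r * Real.sin θ = r' * Real.sin θ' ∧ z = z' := by
  simp [helixPoint]

section Disjoint

variable {d a b c s t e : ℝ}

lemma planar_strands_ne (hd : 0 < d) (ha : a ∈ Icc (0 : ℝ) 1) (hs : s ∈ Icc (0 : ℝ) (1 / 2))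
    (ht : t ∈ Icc (0 : ℝ) (1 / 2)) (he : e ^ 2 = 1) :
    lowerStrand d a 0 0 s ≠ horizontalScale e (upperStrand d a 0 0 t) := by
  have he0 : e ≠ 0 := by
    rintro rfl
    norm_num at he
  rw [lowerStrand, upperStrand, horizontalScale_helixPoint, ne_eq, helixPoint_inj]
  rintro ⟨h0, h1, hz⟩
  have hs0 : planarX a s = 0 := by simpa using h0
  have ht0 : planarX a t = 0 := by simpa [he0] using h1.symm
  have hpos : 0 < separatingHeight d a :=
    convex_combination_mem (convex_Ioi 0) ha (half_pos claspH_pos)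
      (div_pos (ceil_pos hd) four_pos)
  rcases planarZ_of_planarX_eq_zero hd ha hs hs0 with ⟨h, h'⟩ | h <;>
    rcases planarZ_of_planarX_eq_zero hd ha ht ht0 with ⟨k, k'⟩ | k <;> linarith

lemma level_eq_neg_level (hd : 0 < d) (h : planarZ d 1 s = -planarZ d 1 t) :
    level t = -level s := by
  rw [planarZ_one, planarZ_one, ← mul_neg] at h
  linarith [mul_left_cancel₀ (ceil_pos hd).ne' h]

lemma planarX_one_of_level_eq_neg (h : level t = -level s) :
    planarX 1 t = -(2 * Real.sin (screw (level s))) := by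
  rw [planarX_one, h, cos_screw_neg]
  ring

/-- Points at the same height lie on perpendicular lines through the axis, at the positions
`2 cos θ` and `2 sin θ`, which do not vanish simultaneously. -/
lemma twisted_strands_ne (hd : 0 < d) (he : e ^ 2 = 1) :
    lowerStrand d 1 b 0 s ≠ horizontalScale e (upperStrand d 1 b 0 t) := by
  rw [lowerStrand, upperStrand, horizontalScale_helixPoint, ne_eq, helixPoint_inj]
  rintro ⟨h0, h1, hz⟩
  have hlevel := level_eq_neg_level hd hz
  rw [planarX_one, planarX_one_of_level_eq_neg hlevel, hlevel, neg_neg, add_comm (Real.pi / 2),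
    Real.cos_add_pi_div_two] at h0
  rw [planarX_one, planarX_one_of_level_eq_neg hlevel, hlevel, neg_neg, add_comm (Real.pi / 2),
    Real.sin_add_pi_div_two] at h1
  set φ := b * screw (level s)
  set θ := screw (level s)
  have hφ := Real.sin_sq_add_cos_sq φ
  have hcos : Real.cos θ = 0 := by
    linear_combination (-Real.cos θ) * hφ + Real.cos φ / 2 * h0 + Real.sin φ / 2 * h1
  have hsin : Real.sin θ = 0 := by
    linear_combination -Real.sin θ * he - e ^ 2 * Real.sin θ * hφ -
      e * Real.sin φ / 2 * h0 + e * Real.cos φ / 2 * h1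
  simpa [hcos, hsin] using Real.sin_sq_add_cos_sq θ

/-- On the same side of the axis, two strands at the same height are at distance `2` if they are on
a line parallel to the `x₁`-axis, and they are moved by at most `1` along it; the
strands on different sides are moved away from each other. -/
lemma separated_strands_ne (hd : 0 < d) (hc : c ∈ Icc (0 : ℝ) 1) (hs : s ∈ Icc (0 : ℝ) (1 / 2))
    (ht : t ∈ Icc (0 : ℝ) (1 / 2)) (he : e ^ 2 = 1) :
    lowerStrand d 1 1 c s ≠ horizontalScale e (upperStrand d 1 1 c t) := by
  rw [lowerStrand, upperStrand, horizontalScale_helixPoint, ne_eq, helixPoint_inj]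
  rintro ⟨h0, h1, hz⟩
  have hlevel := level_eq_neg_level hd hz
  have hp : c * shift (level s) ∈ Icc (0 : ℝ) 1 :=
    unitInterval.mul_mem hc (shift_mem (level_mem hs).2)
  have hq : c * shift (level t) ∈ Icc (0 : ℝ) 1 :=
    unitInterval.mul_mem hc (shift_mem (level_mem ht).2)
  set p := c * shift (level s)
  set q := c * shift (level t)
  rw [planarX_one, planarX_one_of_level_eq_neg hlevel, hlevel, neg_neg, one_mul,
    add_comm (Real.pi / 2), Real.cos_add_pi_div_two] at h0
  rw [planarX_one, planarX_one_of_level_eq_neg hlevel, hlevel, neg_neg, one_mul,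
    add_comm (Real.pi / 2), Real.sin_add_pi_div_two] at h1
  set θ := screw (level s)
  have hθ := Real.sin_sq_add_cos_sq θ
  rcases sq_eq_one_iff.1 he with rfl | rfl
  · have : Real.cos θ * Real.sin θ = 0 := by linarith
    rcases mul_eq_zero.1 this with h | h <;> rw [h] at h0 hθ <;> nlinarith [hp.1, hp.2, hq.1, hq.2]
  · linarith [hp.1, hq.1]

end Disjoint

lemma lowerStrand_zero (d s : ℝ) : lowerStrand d 0 0 0 s = halfCurve d s := by
  simp [lowerStrand, helixPoint, halfCurve, planarX, planarZ]

lemma upperStrand_zero (d s : ℝ) : upperStrand d 0 0 0 s = interchange (halfCurve d s) := by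
  simp [upperStrand, helixPoint, halfCurve, interchange_apply, planarX, planarZ]

lemma lowerStrand_one (d s : ℝ) :
    lowerStrand d 1 1 1 s = !₂[strandX (level s), strandY (level s), ceil d * level s] := by
  rw [lowerStrand, helixPoint, planarX_one, planarZ_one, one_mul, one_mul, strandX, strandY]
  generalize level s = ζ
  split_ifs with h1 h2
  · rw [screw_of_le h1, shift, min_eq_left (by linarith), Real.cos_zero, Real.sin_zero]
    norm_num
  · rw [screw_of_mem ⟨by linarith, h2⟩, shift, min_eq_left (by linarith)]
    set x := twist ζ / 2
    rw [show twist ζ = 2 * x by ring, Real.cos_two_mul, Real.sin_two_mul]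
    exact vec_ext (by simp; ring) (by simp; ring) rfl
  · rw [cos_screw_of_ge (by linarith), shift, min_eq_right (by linarith)]
    norm_num

/-- The half-turn about the `x₁`-axis. -/
def flip (q : E3) : E3 := !₂[q 0, -q 1, -q 2]

lemma upperStrand_one (d s : ℝ) : upperStrand d 1 1 1 s = flip (lowerStrand d 1 1 1 s) := by
  have hangle : Real.pi / 2 + screw (-level s) = 2 * Real.pi - screw (level s) := by
    rw [screw_neg]
    ring
  rw [upperStrand, lowerStrand, one_mul, one_mul, one_mul, hangle, helixPoint,
    Real.cos_two_pi_sub, Real.sin_two_pi_sub, mul_neg]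
  rfl

/-- The parameter of the first stage of the homotopy. -/
def stageOne (r : I) : ℝ := min 1 (3 * r)

/-- The parameter of the second stage of the homotopy. -/
def stageTwo (r : I) : ℝ := max 0 (min 1 (3 * r - 1))

/-- The parameter of the third stage of the homotopy. -/
def stageThree (r : I) : ℝ := max 0 (3 * r - 2)

lemma stageOne_mem (r : I) : stageOne r ∈ Icc (0 : ℝ) 1 :=
  ⟨le_min zero_le_one (by linarith [r.2.1]), min_le_left _ _⟩

lemma stageThree_mem (r : I) : stageThree r ∈ Icc (0 : ℝ) 1 :=
  ⟨le_max_left _ _, max_le zero_le_one (by linarith [r.2.2])⟩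

lemma stage_cases (r : I) : stageTwo r = 0 ∧ stageThree r = 0 ∨
    stageOne r = 1 ∧ stageThree r = 0 ∨ stageOne r = 1 ∧ stageTwo r = 1 := by
  unfold stageOne stageTwo stageThree
  grind

/-- The link homotopy from the configuration of clasp arcs to the standard picture. -/
def unclasp (d : ℝ) : Fin 2 → I × I → E3 :=
  ![fun p => double (lowerStrand d (stageOne p.1) (stageTwo p.1) (stageThree p.1)) p.2,
    fun p => double (upperStrand d (stageOne p.1) (stageTwo p.1) (stageThree p.1)) p.2]

@[fun_prop]
lemma continuous_screw : Continuous screw := by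
  unfold screw
  fun_prop

@[fun_prop]
lemma continuous_shift : Continuous shift := by
  unfold shift
  fun_prop

@[fun_prop]
lemma continuous_level : Continuous level := by
  unfold level
  fun_prop

lemma continuous_helixPoint {X : Type*} [TopologicalSpace X] {r θ w z : X → ℝ}
    (hr : Continuous r) (hθ : Continuous θ) (hw : Continuous w) (hz : Continuous z) :
    Continuous fun p => helixPoint (r p) (θ p) (w p) (z p) :=
  continuous_vec ((hr.mul (Real.continuous_cos.comp hθ)).add hw)
    (hr.mul (Real.continuous_sin.comp hθ)) hz

lemma continuous_unclasp (d : ℝ) (i : Fin 2) : Continuous (unclasp d i) := by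
  have hone : Continuous stageOne := by unfold stageOne; fun_prop
  have htwo : Continuous stageTwo := by unfold stageTwo; fun_prop
  have hthree : Continuous stageThree := by unfold stageThree; fun_prop
  have hfold := continuous_fold
  have hX : Continuous fun p : I × I => planarX (stageOne p.1) (fold p.2) := by
    have := continuous_halfX_fold.comp (continuous_snd (X := I))
    unfold planarX
    fun_prop
  have hZ : Continuous fun p : I × I => planarZ d (stageOne p.1) (fold p.2) := by
    have := (continuous_halfZ_fold d).comp (continuous_snd (X := I))
    unfold planarZ
    fun_prop
  have hmid : shift (level (1 / 2)) = 0 := by norm_num [shift, level]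
  fin_cases i
  · refine continuous_double (X := I × I) (s := Prod.snd)
      (f := fun p => lowerStrand d (stageOne p.1) (stageTwo p.1) (stageThree p.1)) continuous_snd
      (continuous_helixPoint hX (by fun_prop) (by fun_prop) hZ) (fun p => ?_) fun p => ?_ <;>
      simp only [lowerStrand, helixPoint, Matrix.cons_val, planarX_half, hmid, zero_mul, mul_zero,
        add_zero]
  · refine continuous_double (X := I × I) (s := Prod.snd)
      (f := fun p => upperStrand d (stageOne p.1) (stageTwo p.1) (stageThree p.1)) continuous_snd
      (continuous_helixPoint hX (by fun_prop) (by fun_prop) hZ.neg) (fun p => ?_) fun p => ?_ <;>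
      simp only [upperStrand, helixPoint, Matrix.cons_val, planarX_half, hmid, zero_mul, mul_zero,
        add_zero]

lemma unclasp_zero_apply_two (d : ℝ) (r s : I) :
    unclasp d 0 (r, s) 2 = planarZ d (stageOne r) (fold s) :=
  double_apply_two _ _

lemma unclasp_one_apply_two (d : ℝ) (r s : I) :
    unclasp d 1 (r, s) 2 = -planarZ d (stageOne r) (fold s) :=
  double_apply_two _ _

lemma unclasp_zero_ne_unclasp_one {d : ℝ} (hd : 0 < d) (r s t : I) :
    unclasp d 0 (r, s) ≠ unclasp d 1 (r, t) := by
  refine double_ne_double (fun s hs t ht e he => ?_) s t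
  rcases stage_cases r with ⟨h2, h3⟩ | ⟨h1, h3⟩ | ⟨h1, h2⟩
  · rw [h2, h3]
    exact planar_strands_ne hd (stageOne_mem r) hs ht he
  · rw [h1, h3]
    exact twisted_strands_ne hd he
  · rw [h1, h2]
    exact separated_strands_ne hd (stageThree_mem r) hs ht he

lemma admits_unclasp {d : ℝ} (hd : 0 < d) (r : I) :
    (grannyClasp d).Admits fun i s => unclasp d i (r, s) := by
  refine grannyClasp_admits_iff.2 ⟨unclasp_zero_ne_unclasp_one hd r, ?_, ?_,
    Fin.forall_fin_two.2 ⟨fun s => ?_, fun s => ?_⟩⟩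
  · simp only [unclasp_zero_apply_two, fold_zero, fold_one, planarZ_zero, and_self]
  · simp only [unclasp_one_apply_two, fold_zero, fold_one, planarZ_zero, neg_neg, and_self]
  · rw [unclasp_zero_apply_two]
    exact abs_planarZ_le hd (stageOne_mem r) (fold_mem s)
  · rw [unclasp_one_apply_two, abs_neg]
    exact abs_planarZ_le hd (stageOne_mem r) (fold_mem s)

lemma double_comp {L : E3 → E3}
    (hL : ∀ q, L (horizontalScale (-1) q) = horizontalScale (-1) (L q)) (f : ℝ → E3) (s : ℝ) :
    double (fun s => L (f s)) s = L (double f s) := by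
  unfold double
  split_ifs
  · rfl
  · exact (hL _).symm

lemma unclasp_at_zero (d : ℝ) (i : Fin 2) (s : I) :
    unclasp d i (0, s) = (grannyClasp d).arc i s := by
  have h1 : stageOne 0 = 0 := by norm_num [stageOne]
  have h2 : stageTwo 0 = 0 := by norm_num [stageTwo]
  have h3 : stageThree 0 = 0 := by norm_num [stageThree]
  fin_cases i
  · change double (lowerStrand d (stageOne 0) (stageTwo 0) (stageThree 0)) s = beta d s
    rw [h1, h2, h3, funext (lowerStrand_zero d), beta_eq_double]
  · change double (upperStrand d (stageOne 0) (stageTwo 0) (stageThree 0)) s = gamma d s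
    rw [h1, h2, h3, funext (upperStrand_zero d), gamma_eq_interchange, beta_eq_double]
    refine double_comp (L := interchange) (fun q => vec_ext ?_ ?_ ?_) _ _ <;>
      simp [interchange_apply, horizontalScale]

lemma unclasp_at_one (d : ℝ) (i : Fin 2) (s : I) :
    unclasp d i (1, s) = grannyPicture (ceil d) i s := by
  have h1 : stageOne 1 = 1 := by norm_num [stageOne]
  have h2 : stageTwo 1 = 1 := by norm_num [stageTwo]
  have h3 : stageThree 1 = 1 := by norm_num [stageThree]
  have hlower : double (lowerStrand d 1 1 1) s = lowerRope (ceil d) s := by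
    rw [funext (lowerStrand_one d), double, lowerRope]
    exact if_congr Iff.rfl rfl (vec_ext (neg_one_mul _) (neg_one_mul _) rfl)
  fin_cases i
  · change double (lowerStrand d (stageOne 1) (stageTwo 1) (stageThree 1)) s = _
    rw [h1, h2, h3, hlower]
    rfl
  · change double (upperStrand d (stageOne 1) (stageTwo 1) (stageThree 1)) s = _
    rw [h1, h2, h3, funext (upperStrand_one d),
      double_comp (L := flip) (fun q => vec_ext rfl (by simp [flip, horizontalScale]) rfl), hlower]
    rfl

theorem grannyClasp_linkHomotopicTo {d : ℝ} (hd : 0 < d) :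
    (grannyClasp d).LinkHomotopicTo (grannyPicture (ceil d)) :=
  ⟨unclasp d, continuous_unclasp d, unclasp_at_zero d, unclasp_at_one d, admits_unclasp hd⟩

/-! ### The six clasp arcs of `β` -/

/-- The parameter on `β` of the tip of each of its six clasp arcs. -/
def arcTip : Fin 6 → ℝ := ![2 / 8, 2 / 8, 4 / 8, 4 / 8, 6 / 8, 6 / 8]

/-- The parameter on `β` of the vertical end of each of its six clasp arcs. -/
def arcEnd : Fin 6 → ℝ := ![1 / 8, 3 / 8, 3 / 8, 5 / 8, 5 / 8, 7 / 8]

/-- The parameter on `β` of the point `u` of each of its six clasp arcs. -/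
def arcParam (k : Fin 6) (u : ℝ) : ℝ := AffineMap.lineMap (arcTip k) (arcEnd k) u

/-- The side of the axis on which the arc lies. -/
def arcSide : Fin 6 → ℝ := ![1, -1, -1, 1, 1, -1]

/-- The height of the tip of the arc. -/
def arcBase : Fin 6 → ℝ :=
  ![-claspH / 2, -claspH / 2, 3 * claspH / 2, 3 * claspH / 2, -claspH / 2, -claspH / 2]

/-- The direction, up or down, in which the arc leaves its tip. -/
def arcDir : Fin 6 → ℝ := ![-1, 1, -1, -1, 1, -1]

/-- The arc, parametrized from its tip by the vertical component of the tangent vector. -/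
def arcCurve (k : Fin 6) (u : ℝ) : E3 :=
  !₂[arcSide k * claspX u, 0, arcBase k + arcDir k * claspZ u]

/-- Minus the derivative of the unit tangent vector of the arc with respect to its parameter. -/
def arcForce (k : Fin 6) (u : ℝ) : E3 := !₂[arcSide k * claspSlope u, 0, -arcDir k]

/-- The speed of the parametrization of a clasp arc. -/
def claspSpeed (u : ℝ) : ℝ := deriv claspX u / Real.sqrt (1 - u ^ 2)

lemma arcSide_sq (k : Fin 6) : arcSide k ^ 2 = 1 := by
  fin_cases k <;> norm_num [arcSide]

lemma arcDir_sq (k : Fin 6) : arcDir k ^ 2 = 1 := by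
  fin_cases k <;> norm_num [arcDir]

lemma uIcc_arcTip_arcEnd (k : Fin 6) :
    uIcc (arcTip k) (arcEnd k) = Icc (((k : ℕ) + 1 : ℝ) / 8) (((k : ℕ) + 2 : ℝ) / 8) := by
  fin_cases k <;> norm_num [arcTip, arcEnd, uIcc]

lemma continuous_arcParam (k : Fin 6) : Continuous (arcParam k) := by
  unfold arcParam
  fun_prop

lemma arcParam_mem (k : Fin 6) {u : ℝ} (hu : u ∈ Icc (0 : ℝ) 1) : arcParam k u ∈ Icc (0 : ℝ) 1 :=
  (convex_Icc 0 1).lineMap_mem (by fin_cases k <;> norm_num [arcTip])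
    (by fin_cases k <;> norm_num [arcEnd]) hu

lemma double_of_le (f : ℝ → E3) {s : ℝ} (hs : s ≤ 1 / 2) : double f s = f s := if_pos hs

lemma double_halfCurve_of_ge (d : ℝ) {s : ℝ} (hs : 1 / 2 ≤ s) :
    double (halfCurve d) s = horizontalScale (-1) (halfCurve d (1 - s)) := by
  rcases hs.eq_or_lt with rfl | h
  · rw [double_of_le _ le_rfl]
    have h4 : halfX (8 * (1 / 2)) = 0 := by rw [show (8 : ℝ) * (1 / 2) = 4 by norm_num, halfX_four]
    rw [sub_half, halfCurve, h4]
    refine vec_ext ?_ ?_ ?_ <;> simp [horizontalScale]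
  · exact if_neg h.not_ge

lemma arcParam_rev (k : Fin 6) (u : ℝ) : arcParam k.rev u = 1 - arcParam k u := by
  simp only [arcParam, AffineMap.lineMap_apply_ring']
  fin_cases k <;> simp [arcTip, arcEnd, Fin.rev] <;> ring

lemma arcCurve_rev (k : Fin 6) (u : ℝ) :
    arcCurve k.rev u = horizontalScale (-1) (arcCurve k u) := by
  fin_cases k <;> refine vec_ext ?_ ?_ ?_ <;>
    simp [arcCurve, arcSide, arcBase, arcDir, horizontalScale, Fin.rev]

lemma halfCurve_arcParam (d : ℝ) {k : Fin 6} (hk : k < 3) {u : ℝ} (hu : u ∈ Icc (0 : ℝ) 1) :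
    arcParam k u ≤ 1 / 2 ∧ halfCurve d (arcParam k u) = arcCurve k u := by
  obtain ⟨h0, h1⟩ := hu
  simp only [arcParam, AffineMap.lineMap_apply_ring', halfCurve, arcCurve]
  fin_cases k
  · have hs : 8 * (u * (1 / 8 - 2 / 8) + 2 / 8) = 2 - u := by ring
    simp only [arcTip, arcEnd, arcSide, arcBase, arcDir, Fin.reduceFinMk, Matrix.cons_val, hs]
    rw [halfX_of_mem_one_two ⟨by linarith, by linarith⟩,
      halfZ_of_mem_one_two d ⟨by linarith, by linarith⟩, sub_sub_cancel]
    exact ⟨by linarith, vec_ext (by simp) rfl (by simp [sub_eq_add_neg])⟩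
  · have hs : 8 * (u * (3 / 8 - 2 / 8) + 2 / 8) = 2 + u := by ring
    simp only [arcTip, arcEnd, arcSide, arcBase, arcDir, Fin.reduceFinMk, Matrix.cons_val, hs]
    rw [halfX_of_mem_two_three ⟨by linarith, by linarith⟩,
      halfZ_of_mem_two_three d ⟨by linarith, by linarith⟩, add_sub_cancel_left]
    exact ⟨by linarith, vec_ext (by simp) rfl (by simp)⟩
  · have hs : 8 * (u * (3 / 8 - 4 / 8) + 4 / 8) = 4 - u := by ring
    simp only [arcTip, arcEnd, arcSide, arcBase, arcDir, Fin.reduceFinMk, Matrix.cons_val, hs]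
    rw [halfX_of_mem_three_four ⟨by linarith, by linarith⟩,
      halfZ_of_mem_three_four d ⟨by linarith, by linarith⟩, sub_sub_cancel]
    exact ⟨by linarith, vec_ext (by simp) rfl (by simp [sub_eq_add_neg])⟩
  all_goals exact absurd hk (by decide)

lemma double_halfCurve_arcParam (d : ℝ) (k : Fin 6) {u : ℝ} (hu : u ∈ Icc (0 : ℝ) 1) :
    double (halfCurve d) (arcParam k u) = arcCurve k u := by
  rcases lt_or_ge k 3 with hk | hk
  · obtain ⟨hle, heq⟩ := halfCurve_arcParam d hk hu
    rw [double_of_le _ hle, heq]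
  · have hrev : ∀ k : Fin 6, 3 ≤ k → k.rev < 3 := by decide
    obtain ⟨hle, heq⟩ := halfCurve_arcParam d (hrev k hk) hu
    rw [arcParam_rev] at hle heq
    rw [double_halfCurve_of_ge d (by linarith), heq, ← arcCurve_rev, Fin.rev_rev]

lemma intervalIntegrable_arcForce (k : Fin 6) : IntervalIntegrable (arcForce k) volume 0 1 :=
  intervalIntegrable_vec (intervalIntegrable_claspSlope.const_mul _) (by simp) (by simp)

lemma intervalIntegrable_claspSpeed : IntervalIntegrable claspSpeed volume 0 1 := by
  have h : IntervalIntegrable (fun u => Real.sqrt (1 - u ^ 2) * deriv claspX u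
      + u * (claspSlope u * deriv claspX u)) volume 0 1 :=
    (intervalIntegrable_deriv_claspX.continuousOn_mul (by fun_prop)).add
      (intervalIntegrable_deriv_claspZ.continuousOn_mul (by fun_prop))
  refine h.congr_uIoo ?_
  rw [uIoo_of_le zero_le_one]
  intro u hu
  have hpos := sqrt_one_sub_sq_pos hu
  have hsq : Real.sqrt (1 - u ^ 2) ^ 2 = 1 - u ^ 2 := Real.sq_sqrt (Real.sqrt_pos.1 hpos).le
  simp only [claspSpeed, claspSlope]
  field_simp
  rw [hsq]
  ring

lemma isRegularArc_arcCurve (k : Fin 6) :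
    IsRegularArc (arcCurve k) claspSpeed
      (fun u => !₂[arcSide k * Real.sqrt (1 - u ^ 2), 0, arcDir k * u]) (fun u => -arcForce k u)
      0 1 where
  continuousOn := continuousOn_vec (continuousOn_const.mul continuousOn_claspX)
    continuousOn_const (continuousOn_const.add (continuousOn_const.mul continuousOn_claspZ))
  hasDerivAt u hu := by
    have hpos := sqrt_one_sub_sq_pos hu
    refine (hasDerivAt_vec ((differentiableAt_claspX hu).hasDerivAt.const_mul _)
      (hasDerivAt_const u 0) (((hasDerivAt_claspZ hu).const_mul _).const_add _)).congr_deriv ?_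
    refine vec_ext ?_ ?_ ?_ <;> simp [claspSpeed, claspSlope] <;> field_simp
  speed_pos u hu := div_pos (deriv_claspX_pos hu) (sqrt_one_sub_sq_pos hu)
  continuousOn_speed := (continuousOn_deriv_claspX.mono Ioo_subset_Ioc_self).div (by fun_prop)
    fun u hu => (sqrt_one_sub_sq_pos hu).ne'
  intervalIntegrable_speed := intervalIntegrable_claspSpeed
  continuousOn_tangent := continuousOn_vec (by fun_prop) continuousOn_const (by fun_prop)
  norm_tangent u hu := by
    have hsq : Real.sqrt (1 - u ^ 2) ^ 2 = 1 - u ^ 2 :=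
      Real.sq_sqrt (Real.sqrt_pos.1 (sqrt_one_sub_sq_pos hu)).le
    rw [← sq_eq_sq₀ (norm_nonneg _) zero_le_one, norm_vec_sq]
    simp only [Matrix.cons_val, mul_pow, arcSide_sq, arcDir_sq, hsq]
    ring
  hasDerivAt_tangent u hu := by
    refine (hasDerivAt_vec ((hasDerivAt_sqrt_one_sub_sq hu).const_mul _) (hasDerivAt_const u 0)
      ((hasDerivAt_id u).const_mul _)).congr_deriv ?_
    refine vec_ext ?_ ?_ ?_ <;> simp [arcForce]
  intervalIntegrable_tangent := (intervalIntegrable_arcForce k).neg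

/-! ### The first variation of the length of `β` -/

lemma hasLengthVariation_arc (d : ℝ) (k : Fin 6) {f : ℝ → E3} (hf : ContDiff ℝ 1 f) :
    HasLengthVariation (double (halfCurve d)) f (uIcc (arcTip k) (arcEnd k))
      (arcDir k * f (arcEnd k) 2 - arcSide k * f (arcTip k) 0 +
        ∫ u in (0 : ℝ)..1, inner ℝ (arcForce k u) (f (arcParam k u))) := by
  have hfd : ∀ u, HasDerivAt (f ∘ AffineMap.lineMap (arcTip k) (arcEnd k))
      ((arcEnd k - arcTip k) • deriv f (arcParam k u)) u := fun u =>
    (hf.differentiable one_ne_zero _).hasDerivAt.scomp u AffineMap.hasDerivAt_lineMap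
  have hf' : Continuous fun u => deriv f (arcParam k u) :=
    (hf.continuous_deriv le_rfl).comp (continuous_arcParam k)
  refine HasLengthVariation.of_comp_lineMap (HasLengthVariation.congr ?_
    fun u hu => (double_halfCurve_arcParam d k hu).symm)
  convert (isRegularArc_arcCurve k).hasLengthVariation zero_le_one hfd
    (hf'.fun_const_smul _) using 1
  simp only [inner_neg_left, intervalIntegral.integral_neg, sub_neg_eq_add]
  simp [inner_vec, arcParam]

lemma hasLengthVariation_vertical {g f : ℝ → E3} {p : E3} {v e a b : ℝ} (hv : 0 < v)
    (he : e ^ 2 = 1) (hab : a ≤ b) (hf : ContDiff ℝ 1 f)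
    (hg : ∀ u ∈ Icc a b, g u = p + (v * u) • !₂[0, 0, e]) :
    HasLengthVariation g f (Icc a b) (e * f b 2 - e * f a 2) := by
  have hT : ‖(!₂[0, 0, e] : E3)‖ = 1 := by
    rw [← sq_eq_sq₀ (norm_nonneg _) zero_le_one, norm_vec_sq]
    simp [he]
  refine HasLengthVariation.congr ?_ fun u hu => (hg u hu).symm
  convert (isRegularArc_segment hv hT a b).hasLengthVariation hab
    (fun u => (hf.differentiable one_ne_zero u).hasDerivAt) (hf.continuous_deriv le_rfl) using 1
  simp [inner_vec]

lemma hasLengthVariation_double_halfCurve_arcs (d : ℝ) {f : ℝ → E3} (hf : ContDiff ℝ 1 f) :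
    HasLengthVariation (double (halfCurve d)) f (Icc (1 / 8) (7 / 8))
      (∑ k, (arcDir k * f (arcEnd k) 2 - arcSide k * f (arcTip k) 0 +
        ∫ u in (0 : ℝ)..1, inner ℝ (arcForce k u) (f (arcParam k u)))) := by
  have hmono : Monotone fun k : ℕ => ((k : ℝ) + 1) / 8 := fun k l hkl => by
    dsimp only
    gcongr
  have h := HasLengthVariation.append_sum hmono fun k : Fin 6 => by
    have hk := hasLengthVariation_arc d k hf
    rwa [uIcc_arcTip_arcEnd, show ((k : ℕ) + 2 : ℝ) = ((k + 1 : ℕ) : ℝ) + 1 by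
      push_cast; ring] at hk
  rwa [show (((0 : ℕ) : ℝ) + 1) / 8 = 1 / 8 by norm_num,
    show (((6 : ℕ) : ℝ) + 1) / 8 = 7 / 8 by norm_num] at h

theorem hasLengthVariation_double_halfCurve {d : ℝ} (hd : 0 < d) {f : ℝ → E3}
    (hf : ContDiff ℝ 1 f) :
    HasLengthVariation (double (halfCurve d)) f (Icc 0 1) (-(f 0 2) - f 1 2 +
      ∑ k, ∫ u in (0 : ℝ)..1, inner ℝ (arcForce k u) (f (arcParam k u))) := by
  have hfirst : HasLengthVariation (double (halfCurve d)) f (Icc 0 (1 / 8))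
      (1 * f (1 / 8) 2 - 1 * f 0 2) := by
    refine hasLengthVariation_vertical (p := !₂[1, 0, -ceil d]) (v := 8 * d) (by positivity)
      (one_pow 2) (by norm_num) hf fun u hu => ?_
    have hu' : 8 * u ∈ Icc (0 : ℝ) 1 := ⟨by linarith [hu.1], by linarith [hu.2]⟩
    rw [double_of_le _ (by linarith [hu.2]), halfCurve, halfX_of_mem_zero_one hu',
      halfZ_of_mem_zero_one d hu']
    exact vec_ext (by simp) (by simp) (by simp; ring)
  have hlast : HasLengthVariation (double (halfCurve d)) f (Icc (7 / 8) 1)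
      (-1 * f 1 2 - -1 * f (7 / 8) 2) := by
    refine hasLengthVariation_vertical (p := !₂[-1, 0, -ceil d + 8 * d]) (v := 8 * d)
      (by positivity) (by norm_num) (by norm_num) hf fun u hu => ?_
    have hu' : 8 * (1 - u) ∈ Icc (0 : ℝ) 1 := ⟨by linarith [hu.2], by linarith [hu.1]⟩
    rw [double_halfCurve_of_ge d (by linarith [hu.1]), halfCurve, halfX_of_mem_zero_one hu',
      halfZ_of_mem_zero_one d hu']
    exact vec_ext (by simp [horizontalScale]) (by simp [horizontalScale])
      (by simp [horizontalScale]; ring)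
  convert (hfirst.append (hasLengthVariation_double_halfCurve_arcs d hf) (by norm_num)
    (by norm_num)).append hlast (by norm_num) (by norm_num) using 1
  have hboundary : ∑ k, (arcDir k * f (arcEnd k) 2 - arcSide k * f (arcTip k) 0) =
      -(f (7 / 8) 2) - f (1 / 8) 2 := by
    simp only [Fin.sum_univ_six, arcDir, arcSide, arcEnd, arcTip, Matrix.cons_val]
    ring
  rw [Finset.sum_add_distrib, hboundary]
  ring

/-- `arcParam k u` as a point of the unit interval, on which `β` is parametrized. -/
def arcPoint (k : Fin 6) (u : ℝ) : I := projIcc 0 1 zero_le_one (arcParam k u)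

lemma continuous_arcPoint (k : Fin 6) : Continuous (arcPoint k) :=
  continuous_projIcc.comp (continuous_arcParam k)

lemma coe_arcPoint (k : Fin 6) {u : ℝ} (hu : u ∈ Icc (0 : ℝ) 1) :
    (arcPoint k u : ℝ) = arcParam k u := by
  rw [arcPoint, projIcc_of_mem _ (arcParam_mem k hu)]

lemma beta_arcPoint (d : ℝ) (k : Fin 6) {u : ℝ} (hu : u ∈ Icc (0 : ℝ) 1) :
    beta d (arcPoint k u) = arcCurve k u := by
  rw [beta_eq_double, coe_arcPoint k hu, double_halfCurve_arcParam d k hu]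

lemma intervalIntegrable_arcForce_inner (k : Fin 6) (ζ : C(I, E3)) :
    IntervalIntegrable (fun u => inner ℝ (arcForce k u) (ζ (arcPoint k u))) volume 0 1 :=
  intervalIntegrable_inner (intervalIntegrable_arcForce k)
    (ζ.continuous.comp (continuous_arcPoint k)).continuousOn

/-- The power of the curvature force of a clasp arc along a vector field on `β`. -/
def arcPower (k : Fin 6) : C(I, E3) →L[ℝ] ℝ :=
  LinearMap.mkContinuous
    { toFun := fun ζ => ∫ u in (0 : ℝ)..1, inner ℝ (arcForce k u) (ζ (arcPoint k u))
      map_add' := fun ζ η => by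
        simp only [ContinuousMap.add_apply, inner_add_right]
        exact intervalIntegral.integral_add (intervalIntegrable_arcForce_inner k ζ)
          (intervalIntegrable_arcForce_inner k η)
      map_smul' := fun c ζ => by
        simp only [ContinuousMap.smul_apply, real_inner_smul_right,
          intervalIntegral.integral_const_mul, RingHom.id_apply, smul_eq_mul] }
    (∫ u in (0 : ℝ)..1, ‖arcForce k u‖) fun ζ => by
      refine (intervalIntegral.norm_integral_le_integral_norm zero_le_one).trans ?_
      rw [← intervalIntegral.integral_mul_const]
      refine intervalIntegral.integral_mono_on zero_le_one
        (intervalIntegrable_arcForce_inner k ζ).norm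
        ((intervalIntegrable_arcForce k).norm.mul_const _) fun u _ => ?_
      exact (norm_inner_le_norm _ _).trans
        (mul_le_mul_of_nonneg_left (ζ.norm_coe_le_norm _) (norm_nonneg _))

lemma arcPower_apply (k : Fin 6) (ζ : C(I, E3)) :
    arcPower k ζ = ∫ u in (0 : ℝ)..1, inner ℝ (arcForce k u) (ζ (arcPoint k u)) := rfl

/-- The first variation of the length of `β`: the endpoints contribute the unit vectors tangent to
the segments, the clasp arcs their curvature force. -/
def betaVariation : C(I, E3) →L[ℝ] ℝ :=
  -(height ∘L ContinuousMap.evalCLM ℝ (0 : I)) - height ∘L ContinuousMap.evalCLM ℝ (1 : I)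
    + ∑ k, arcPower k

lemma betaVariation_apply (ζ : C(I, E3)) :
    betaVariation ζ = -(ζ 0 2) - ζ 1 2 + ∑ k, arcPower k ζ := by
  simp [betaVariation, height]

lemma hasLengthVariation_beta {d : ℝ} (hd : 0 < d) {ζ : C(I, E3)} {f : ℝ → E3}
    (hf : ContDiff ℝ 1 f) (hζ : ∀ s : I, ζ s = f s) :
    HasLengthVariation (beta d) ζ univ (betaVariation ζ) := by
  rw [funext (beta_eq_double d), funext hζ]
  convert (hasLengthVariation_double_halfCurve hd hf).comp_coe_unitInterval using 1
  rw [betaVariation_apply, hζ, hζ]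
  refine congrArg _ (Finset.sum_congr rfl fun k _ => ?_)
  rw [arcPower_apply]
  refine intervalIntegral.integral_congr fun u hu => ?_
  rw [uIcc_of_le zero_le_one] at hu
  simp only [hζ, coe_arcPoint k hu]

lemma interchange_interchange (q : E3) : interchange (interchange q) = q := by
  refine vec_ext ?_ ?_ ?_ <;> simp [interchange_apply]

/-- The isometry `interchange`, which carries `β` to `γ`, acting on vector fields. -/
def interchangeField : C(I, E3) →L[ℝ] C(I, E3) :=
  interchange.toContinuousLinearMap.compLeftContinuous ℝ I

lemma interchangeField_apply (ζ : C(I, E3)) (s : I) :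
    interchangeField ζ s = interchange (ζ s) := rfl

lemma hasLengthVariation_gamma {d : ℝ} (hd : 0 < d) {ζ : C(I, E3)} {f : ℝ → E3}
    (hf : ContDiff ℝ 1 f) (hζ : ∀ s : I, ζ s = f s) :
    HasLengthVariation (gamma d) ζ univ (betaVariation (interchangeField ζ)) := by
  have h := (hasLengthVariation_beta hd (ζ := interchangeField ζ)
    (interchange.contDiff.comp hf) fun s => by
      rw [interchangeField_apply, hζ, Function.comp_apply]).comp_linearIsometry interchange
  simp only [interchangeField_apply, interchange_interchange] at h
  exact h

/-- The first variation of the length of the granny clasp. -/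
def grannyVariation : (Fin 2 → C(I, E3)) →L[ℝ] ℝ :=
  ∑ i, (![betaVariation, betaVariation ∘L interchangeField] i) ∘L ContinuousLinearMap.proj i

lemma grannyVariation_apply (ξ : Fin 2 → C(I, E3)) :
    grannyVariation ξ = betaVariation (ξ 0) + betaVariation (interchangeField (ξ 1)) := by
  simp [grannyVariation]

theorem isFirstVariationOfLen_grannyVariation {d : ℝ} (hd : 0 < d) :
    IsFirstVariationOfLen (grannyClasp d).arc grannyVariation :=
  isFirstVariationOfLen_sum (Fin.forall_fin_two.2
    ⟨fun _ _ hf hζ => hasLengthVariation_beta hd hf hζ,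
      fun _ _ hf hζ => hasLengthVariation_gamma hd hf hζ⟩)

/-! ### Struts and strong criticality -/

/-- The arc `k` of `β` and the image under `interchange` of the arc `l` of `β`, which is an arc of
`γ`, belong to the same clasp. -/
def IsOpposite (k l : Fin 6) : Prop :=
  arcDir l = arcDir k ∧ arcBase k + arcBase l = -(arcDir k * claspH)

/-- The strut from the arc `l` of `γ` to the arc `k` of `β`, when these belong to the same clasp. -/
def strut (k l : Fin 6) (u : ℝ) : E3 :=
  !₂[arcSide k * claspX u, -(arcSide l * claspX (1 - u)), -(arcDir k * gap u)]

lemma beta_sub_gamma_eq_strut (d : ℝ) {k l : Fin 6} (h : IsOpposite k l) {u : ℝ}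
    (hu : u ∈ Icc (0 : ℝ) 1) :
    beta d (arcPoint k u) - gamma d (arcPoint l (1 - u)) = strut k l u := by
  rw [gamma_eq_interchange, beta_arcPoint d k hu, beta_arcPoint d l (Icc.one_sub_mem hu)]
  have hgap := claspH_sub_eq_gap hu
  refine vec_ext ?_ ?_ ?_
  · simp [arcCurve, interchange_apply, strut]
  · simp [arcCurve, interchange_apply, strut]
  · simp only [arcCurve, interchange_apply, strut, PiLp.sub_apply, Matrix.cons_val, h.1]
    linear_combination h.2 - arcDir k * hgap

lemma norm_strut (k l : Fin 6) {u : ℝ} (hu : u ∈ Icc (0 : ℝ) 1) : ‖strut k l u‖ = 1 := by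
  rw [← sq_eq_sq₀ (norm_nonneg _) zero_le_one, norm_vec_sq]
  simp only [strut, Matrix.cons_val, neg_sq, mul_pow, arcSide_sq, arcDir_sq]
  linear_combination strut_sq hu

/-- The two arcs of `γ` that are opposite to each arc of `β`. -/
def opposite : Fin 2 → Fin 6 → Fin 6 := ![![2, 1, 0, 0, 1, 2], ![3, 4, 5, 5, 4, 3]]

lemma isOpposite_opposite (m : Fin 2) (k : Fin 6) : IsOpposite k (opposite m k) := by
  fin_cases m <;> fin_cases k <;>
    simp only [IsOpposite, opposite, arcDir, arcBase] <;>
    simp <;> ring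

theorem gThi_grannyClasp (d : ℝ) : gThi (grannyClasp d).arc = 1 := by
  rw [gThi_fin_two]
  refine IsLeast.csInf_eq ⟨⟨(arcPoint 0 0, arcPoint (opposite 0 0) (1 - 0)), ?_⟩, ?_⟩
  · have hstrut := beta_sub_gamma_eq_strut d (isOpposite_opposite 0 0) (left_mem_Icc.2 zero_le_one)
    exact (congrArg norm hstrut).trans (norm_strut _ _ (left_mem_Icc.2 zero_le_one))
  · rintro _ ⟨k, rfl⟩
    exact (one_le_dist_beta_gamma d k.1 k.2).trans_eq (dist_eq_norm _ _)

lemma exists_hasDerivWithinAt_gThi_grannyClasp (d : ℝ) (ξ : Fin 2 → C(I, E3)) :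
    ∃ a, HasDerivWithinAt (fun t : ℝ => gThi (move (grannyClasp d).arc ξ t)) a (Ici 0) 0 ∧
      ∀ k l, IsOpposite k l → ∀ u ∈ Icc (0 : ℝ) 1,
        a ≤ inner ℝ (strut k l u) (ξ 0 (arcPoint k u) - ξ 1 (arcPoint l (1 - u))) := by
  have hne : ∀ s t, (grannyClasp d).arc 0 s ≠ (grannyClasp d).arc 1 t := fun s t =>
    dist_pos.1 (one_pos.trans_le (one_le_dist_beta_gamma d s t))
  obtain ⟨a, ha, hle⟩ := exists_hasDerivWithinAt_gThi (continuous_grannyClasp_arc d) hne ξ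
  refine ⟨a, ha, fun k l hkl u hu => ?_⟩
  have hstrut : (grannyClasp d).arc 0 (arcPoint k u) - (grannyClasp d).arc 1 (arcPoint l (1 - u))
      = strut k l u := beta_sub_gamma_eq_strut d hkl hu
  have h := hle (arcPoint k u) (arcPoint l (1 - u))
    (by rw [hstrut, norm_strut k l hu, gThi_grannyClasp])
  rwa [hstrut, gThi_grannyClasp, div_one] at h

lemma exists_hasDerivWithinAt_obst_grannyClasp (d : ℝ) (ξ : Fin 2 → C(I, E3)) :
    ∃ b, HasDerivWithinAt
      (fun t : ℝ => obst (grannyClasp d).g (move (grannyClasp d).arc ξ t)) b (Ici 0) 0 := by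
  have hg : (grannyClasp d).g = fun j q => ceil d + (![height, -height] : Fin 2 → E3 →L[ℝ] ℝ) j q :=
    funext (Fin.forall_fin_two.2
      ⟨funext fun q => add_comm _ _, funext fun q => sub_eq_add_neg _ _⟩)
  rw [hg]
  exact exists_hasDerivWithinAt_obst (fun _ => ceil d) ![height, -height]
    (continuous_grannyClasp_arc d) ξ

/-- The power, along a vector field on `β`, of the curvature forces at the points `u` of the clasp
arcs. -/
def curvaturePower (ζ : C(I, E3)) (u : ℝ) : ℝ := ∑ k, inner ℝ (arcForce k u) (ζ (arcPoint k u))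

lemma intervalIntegrable_curvaturePower (ζ : C(I, E3)) :
    IntervalIntegrable (curvaturePower ζ) volume 0 1 := by
  have h := IntervalIntegrable.sum Finset.univ fun k _ => intervalIntegrable_arcForce_inner k ζ
  rw [Finset.sum_fn] at h
  exact h

lemma betaVariation_eq_integral {ζ : C(I, E3)} (h0 : ζ 0 2 = 0) (h1 : ζ 1 2 = 0) :
    betaVariation ζ = ∫ u in (0 : ℝ)..1, curvaturePower ζ u := by
  simp only [betaVariation_apply, h0, h1, arcPower_apply, curvaturePower]
  rw [intervalIntegral.integral_finsetSum fun k _ => intervalIntegrable_arcForce_inner k ζ]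
  ring

/-- The power of the curvature forces at the points `u` of the arcs of `β` and at the points `1 - u`
of the arcs of `γ`, which are the ends of the struts at `u`. -/
def strutPower (ξ : Fin 2 → C(I, E3)) (u : ℝ) : ℝ :=
  curvaturePower (ξ 0) u + curvaturePower (interchangeField (ξ 1)) (1 - u)

lemma intervalIntegrable_curvaturePower_one_sub (ζ : C(I, E3)) :
    IntervalIntegrable (fun u => curvaturePower ζ (1 - u)) volume 0 1 := by
  simpa using ((intervalIntegrable_curvaturePower ζ).comp_sub_left 1).symm

lemma intervalIntegrable_strutPower (ξ : Fin 2 → C(I, E3)) :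
    IntervalIntegrable (strutPower ξ) volume 0 1 :=
  (intervalIntegrable_curvaturePower _).add (intervalIntegrable_curvaturePower_one_sub _)

lemma grannyVariation_eq_integral {d : ℝ} {ξ : Fin 2 → C(I, E3)}
    (hξ : (grannyClasp d).Compatible ξ) :
    grannyVariation ξ = ∫ u in (0 : ℝ)..1, strutPower ξ u := by
  have hend : ∀ i, ξ i 0 2 = 0 ∧ ξ i 1 2 = 0 := Fin.forall_fin_two.2
    ⟨(hξ 0).imp mem_horizontalPlane_direction.1 mem_horizontalPlane_direction.1,
      (hξ 1).imp mem_horizontalPlane_direction.1 mem_horizontalPlane_direction.1⟩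
  have hend' : ∀ s, ξ 1 s 2 = 0 → interchangeField (ξ 1) s 2 = 0 := fun s hs => neg_eq_zero.2 hs
  unfold strutPower
  rw [grannyVariation_apply, betaVariation_eq_integral (hend 0).1 (hend 0).2,
    betaVariation_eq_integral (hend' 0 (hend 1).1) (hend' 1 (hend 1).2),
    intervalIntegral.integral_add (intervalIntegrable_curvaturePower _)
      (intervalIntegrable_curvaturePower_one_sub _), intervalIntegral.integral_comp_sub_left,
    sub_self, sub_zero]

/-- The curvature forces are balanced by the struts: this is `claspX = gap * claspSlope`, at both
ends of each strut. -/
lemma sum_inner_strut_eq (ξ : Fin 2 → C(I, E3)) {u : ℝ} (hu : u ∈ Ioo (0 : ℝ) 1) :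
    ∑ k, ∑ m, inner ℝ (strut k (opposite m k) u)
      (ξ 0 (arcPoint k u) - ξ 1 (arcPoint (opposite m k) (1 - u))) =
      2 * gap u * strutPower ξ u := by
  have hbeta := claspX_eq_gap_mul_claspSlope hu
  have hgamma := claspX_eq_gap_mul_claspSlope (Ioo.one_sub_mem hu)
  rw [gap_one_sub] at hgamma
  unfold strutPower curvaturePower
  generalize hx : (fun k => ξ 0 (arcPoint k u)) = x
  generalize hy : (fun l => ξ 1 (arcPoint l (1 - u))) = y
  have hx' : ∀ k, ξ 0 (arcPoint k u) = x k := congrFun hx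
  have hy' : ∀ l, ξ 1 (arcPoint l (1 - u)) = y l := congrFun hy
  simp only [interchangeField_apply, hx', hy', Fin.sum_univ_six, Fin.sum_univ_two, inner_vec,
    strut, arcForce, interchange_apply, arcSide, arcDir, opposite, hbeta, hgamma,
    PiLp.sub_apply, Matrix.cons_val]
  ring

lemma mul_integral_inv_gap_le_grannyVariation {d a : ℝ} {ξ : Fin 2 → C(I, E3)}
    (hξ : (grannyClasp d).Compatible ξ)
    (ha : ∀ k l, IsOpposite k l → ∀ u ∈ Icc (0 : ℝ) 1,
      a ≤ inner ℝ (strut k l u) (ξ 0 (arcPoint k u) - ξ 1 (arcPoint l (1 - u)))) :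
    6 * a * ∫ u in (0 : ℝ)..1, 1 / gap u ≤ grannyVariation ξ := by
  rw [grannyVariation_eq_integral hξ, ← intervalIntegral.integral_const_mul]
  refine intervalIntegral.integral_mono_on_of_le_Ioo zero_le_one
    (intervalIntegrable_inv_gap.const_mul _) (intervalIntegrable_strutPower ξ) fun u hu => ?_
  have hsum : ∑ _k : Fin 6, ∑ _m : Fin 2, a ≤ 2 * gap u * strutPower ξ u := by
    rw [← sum_inner_strut_eq ξ hu]
    exact Finset.sum_le_sum fun k _ => Finset.sum_le_sum fun m _ =>
      ha k _ (isOpposite_opposite m k) u (Ioo_subset_Icc_self hu)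
  simp only [Finset.sum_const, Finset.card_univ, Fintype.card_fin, nsmul_eq_mul] at hsum
  rw [mul_one_div, div_le_iff₀ (gap_pos hu)]
  push_cast at hsum
  linarith

theorem stronglyCritical_grannyClasp {d : ℝ} (hd : 0 < d) : (grannyClasp d).StronglyCritical := by
  have hpos : 0 < ∫ u in (0 : ℝ)..1, 1 / gap u :=
    intervalIntegral.intervalIntegral_pos_of_pos_on intervalIntegrable_inv_gap
      (fun u hu => one_div_pos.2 (gap_pos hu)) zero_lt_one
  refine ⟨grannyVariation, isFirstVariationOfLen_grannyVariation hd,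
    1 / (6 * ∫ u in (0 : ℝ)..1, 1 / gap u), by positivity, fun ξ hξ hF => ?_⟩
  obtain ⟨a, ha, hstrut⟩ := exists_hasDerivWithinAt_gThi_grannyClasp d ξ
  obtain ⟨b, hb⟩ := exists_hasDerivWithinAt_obst_grannyClasp d ξ
  refine ⟨a, b, ha, hb, (min_le_left a b).trans ?_⟩
  have hle := mul_integral_inv_gap_le_grannyVariation hξ hstrut
  rw [hF] at hle
  rw [← neg_div, le_div_iff₀ (by positivity)]
  linarith

end Gehring

end

theorem theorem7p1 (d : ℝ) (hd : 0 < d) :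
    -- the configuration is a generalized link, of Gehring thickness `1`
    (Gehring.grannyClasp d).IsGenLink ∧
    Gehring.gThi (Gehring.grannyClasp d).arc = 1 ∧
    -- it is in the link-homotopy class of the granny clasp
    (Gehring.grannyClasp d).LinkHomotopicTo (Gehring.grannyPicture (Gehring.ceil d)) ∧
    -- it is not embedded: each component has exactly one self-intersection
    (∀ i : Fin 2, ∃! q : Gehring.E3, ∃ s t : unitInterval, s ≠ t ∧
      (Gehring.grannyClasp d).arc i s = q ∧ (Gehring.grannyClasp d).arc i t = q) ∧
    -- it is strongly critical for Gehring ropelength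
    (Gehring.grannyClasp d).StronglyCritical :=
  ⟨Gehring.grannyClasp_isGenLink hd, Gehring.gThi_grannyClasp d,
    Gehring.grannyClasp_linkHomotopicTo hd, Gehring.existsUnique_self_intersection hd,
    Gehring.stronglyCritical_grannyClasp hd⟩
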